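/- Let $d\ge 5$, let $F$ be a field, and let $\mathrm{UT}(d,F)$ be the group of lower unitriangular $d\times d$ matrices over $F$. For $i>j$ let $xe_{i,j}$ be the matrix with $x\in F$ in position $(i,j)$ and $0$ elsewhere; write an element $1+m$ of $\mathrm{UT}(d,F)$ simply as the strictly lower triangular matrix $m$. The elements $xe_{i+1,i}$ ($1\le i\le d-1$, $x\in F$) generate $\mathrm{UT}(d,F)$ and are called its generators. Then the automorphism group of $\mathrm{UT}(d,F)$ is generated by the automorphisms of the following kinds. 1. Extremal automorphisms. If $\operatorname{char}F\neq 2$: the automorphisms $$xe_{2,1}\mapsto xe_{2,1}+ax\,e_{d,2}+\lambda(x)e_{d,1}\qquad(x\in F)$$ fixing all other generators, and the automorphisms $$xe_{d,d-1}\mapsto xe_{d,d-1}+ax\,e_{d-1,1}+\lambda(x)e_{d,1}\qquad(x\in F)$$ fixing all other generators, where $a\in F$ and $\lambda:F\to F$ satisfy $\lambda(x+y)-\lambda(x)-\lambda(y)=axy$ for all $x,y\in F$. If $\operatorname{char}F=2$: the automorphisms $xe_{2,1}\mapsto xe_{2,1}+ax\,e_{d,3}$ $(x\in F)$ fixing all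 other generators, and the automorphisms $xe_{d,d-1}\mapsto xe_{d,d-1}+ax\,e_{d-2,1}$ $(x\in F)$ fixing all other generators, where $a\in F$ is such that the given assignment does define an automorphism. 2. Field automorphisms: $xe_{i+1,i}\mapsto \mu(x)e_{i+1,i}$ for all $i$ and $x$, where $\mu$ is an automorphism of the field $F$. 3. Diagonal automorphisms: conjugations $g\mapsto D^{-1}gD$ by invertible diagonal matrices $D$. 4. Inner automorphisms. 5. Central automorphisms: those commuting with every inner automorphism. 6. The flip along the anti-diagonal: the automorphism with $xe_{i+1,i}\mapsto xe_{d-i+1,d-i}$ for all $1\le i\le d-1$ and $x\in F$. Moreover, if $\operatorname{char}F=2$ and some extremal automorphism of $\mathrm{UT}(d,F)$ is not central, then $F\cong\mathbb{Z}/2\mathbb{Z}$. -/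

import Mathlib

open Matrix

/-- The group `UT(d, F)` of lower unitriangular `d × d` matrices over `F`, under matrix
multiplication. -/
def UT (d : ℕ) (F : Type*) [Field F] : Subgroup (Matrix.GeneralLinearGroup (Fin d) F) where
  carrier := {g | (∀ i, g.val i i = 1) ∧ ∀ i j, i < j → g.val i j = 0}
  one_mem' := ⟨fun i => by simp, fun i j h => by simp [h.ne]⟩
  mul_mem' := by
    rintro a b ⟨ha1, ha2⟩ ⟨hb1, hb2⟩
    refine ⟨fun i => ?_, fun i j hij => ?_⟩
    · rw [Units.val_mul, Matrix.mul_apply, Finset.sum_eq_single i]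
      · rw [ha1, hb1, one_mul]
      · intro k _ hk
        rcases lt_or_gt_of_ne hk with h | h
        · rw [hb2 k i h, mul_zero]
        · rw [ha2 i k h, zero_mul]
      · simp
    · rw [Units.val_mul, Matrix.mul_apply]
      refine Finset.sum_eq_zero fun k _ => ?_
      rcases lt_or_ge i k with h | h
      · rw [ha2 i k h, zero_mul]
      · rw [hb2 k j (lt_of_le_of_lt h hij), mul_zero]
  inv_mem' := by
    rintro a ⟨ha1, ha2⟩
    have hinv : (a⁻¹).val * a.val = 1 := by rw [← Units.val_mul]; simp
    have hz : ∀ i j, i < j → (a⁻¹).val i j = 0 := by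
      have ht : a.val.BlockTriangular OrderDual.toDual := fun i j h => ha2 i j h
      haveI : Invertible a.val := a.invertible
      have h := Matrix.blockTriangular_inv_of_blockTriangular ht
      intro i j hij
      rw [Matrix.coe_units_inv]
      exact h hij
    refine ⟨fun i => ?_, hz⟩
    have h := congrFun (congrFun hinv i) i
    rw [Matrix.mul_apply, Finset.sum_eq_single i] at h
    · simpa [ha1 i] using h
    · intro k _ hk
      rcases lt_or_gt_of_ne hk with h' | h'
      · rw [ha2 k i h', mul_zero]
      · rw [hz i k h', zero_mul]
    · simp

namespace UT

variable {d : ℕ} {F : Type*} [Field F]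

/-- The matrix underlying an element of `UT(d, F)`. -/
def toMatrix (g : UT d F) : Matrix (Fin d) (Fin d) F := (g : Matrix.GeneralLinearGroup (Fin d) F).val

/-- For `i > j`, the elementary unitriangular matrix `1 + x e_{i,j}`. -/
noncomputable def elem (i j : Fin d) (h : j < i) (x : F) : UT d F :=
  ⟨Matrix.GeneralLinearGroup.mkOfDetNeZero (Matrix.transvection i j x)
      (by rw [Matrix.det_transvection_of_ne i j h.ne' x]; exact one_ne_zero), by
    change (∀ k, Matrix.transvection i j x k k = 1) ∧
      ∀ k l, k < l → Matrix.transvection i j x k l = 0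
    refine ⟨fun k => ?_, fun k l hkl => ?_⟩
    · have : ¬ (i = k ∧ j = k) := by rintro ⟨rfl, rfl⟩; exact lt_irrefl _ h
      simp [Matrix.transvection, Matrix.single_apply, this]
    · have : ¬ (i = k ∧ j = l) := by rintro ⟨rfl, rfl⟩; exact lt_asymm h hkl
      simp [Matrix.transvection, Matrix.single_apply, this, hkl.ne]⟩

/-- The generators `1 + x e_{j+1,j}` on the first subdiagonal. -/
noncomputable def gen (i j : Fin d) (h : (i : ℕ) = j + 1) (x : F) : UT d F :=
  elem i j (Fin.lt_def.2 (by omega)) x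

/-- The first index. -/
def i₁ (hd : 5 ≤ d) : Fin d := ⟨0, by omega⟩

/-- The second index. -/
def i₂ (hd : 5 ≤ d) : Fin d := ⟨1, by omega⟩

/-- The third index. -/
def i₃ (hd : 5 ≤ d) : Fin d := ⟨2, by omega⟩

/-- `φ` fixes every generator `1 + x e_{i,j}` on the first subdiagonal whose position `(i, j)`
is different from `(p, q)`. -/
def FixesOtherGens (φ : MulAut (UT d F)) (p q : Fin d) : Prop :=
  ∀ (i j : Fin d) (h : (i : ℕ) = j + 1), (i, j) ≠ (p, q) → ∀ x : F, φ (gen i j h x) = gen i j h x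

/-- Extremal automorphisms in characteristic different from `2`: either
`x e_{2,1} ↦ x e_{2,1} + a x e_{d,2} + x^lam e_{d,1}`, or
`x e_{d,d-1} ↦ x e_{d,d-1} + a x e_{d-1,1} + x^lam e_{d,1}`, the other generators being fixed,
with `(x + y)^lam - x^lam - y^lam = a x y` (so that `a = 2^lam - 2 (1^lam)`).
Here `Fin.rev` turns the first, second index into the indices `d`, `d - 1`. -/
def IsExtremalOdd (hd : 5 ≤ d) (φ : MulAut (UT d F)) : Prop :=
  ∃ (a : F) (lam : F → F), (∀ x y, lam (x + y) - lam x - lam y = a * x * y) ∧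
    (((∀ x : F, toMatrix (φ (gen (i₂ hd) (i₁ hd) rfl x)) =
          1 + single (i₂ hd) (i₁ hd) x + single (i₁ hd).rev (i₂ hd) (a * x)
            + single (i₁ hd).rev (i₁ hd) (lam x)) ∧
        FixesOtherGens φ (i₂ hd) (i₁ hd)) ∨
     ((∀ x : F, toMatrix (φ (gen (i₁ hd).rev (i₂ hd).rev
            (by simp only [Fin.val_rev, i₁, i₂]; omega) x)) =
          1 + single (i₁ hd).rev (i₂ hd).rev x + single (i₂ hd).rev (i₁ hd) (a * x)
            + single (i₁ hd).rev (i₁ hd) (lam x)) ∧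
        FixesOtherGens φ (i₁ hd).rev (i₂ hd).rev))

/-- Extremal automorphisms in characteristic `2`: either
`x e_{2,1} ↦ x e_{2,1} + a x e_{d,3}`, or `x e_{d,d-1} ↦ x e_{d,d-1} + a x e_{d-2,1}`,
the other generators being fixed. -/
def IsExtremalEven (hd : 5 ≤ d) (φ : MulAut (UT d F)) : Prop :=
  ∃ a : F,
    (((∀ x : F, toMatrix (φ (gen (i₂ hd) (i₁ hd) rfl x)) =
          1 + single (i₂ hd) (i₁ hd) x + single (i₁ hd).rev (i₃ hd) (a * x)) ∧
        FixesOtherGens φ (i₂ hd) (i₁ hd)) ∨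
     ((∀ x : F, toMatrix (φ (gen (i₁ hd).rev (i₂ hd).rev
            (by simp only [Fin.val_rev, i₁, i₂]; omega) x)) =
          1 + single (i₁ hd).rev (i₂ hd).rev x + single (i₃ hd).rev (i₁ hd) (a * x)) ∧
        FixesOtherGens φ (i₁ hd).rev (i₂ hd).rev))

/-- Extremal automorphisms. -/
def IsExtremal (hd : 5 ≤ d) (φ : MulAut (UT d F)) : Prop :=
  (ringChar F ≠ 2 ∧ IsExtremalOdd hd φ) ∨ (ringChar F = 2 ∧ IsExtremalEven hd φ)

/-- Field automorphisms: `x e_{i+1,i} ↦ x^μ e_{i+1,i}` for a field automorphism `μ` of `F`. -/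
def IsFieldAut (φ : MulAut (UT d F)) : Prop :=
  ∃ μ : F ≃+* F, ∀ (i j : Fin d) (h : (i : ℕ) = j + 1) (x : F),
    φ (gen i j h x) = gen i j h (μ x)

/-- Diagonal automorphisms: conjugation by an invertible diagonal matrix. -/
def IsDiagonalAut (φ : MulAut (UT d F)) : Prop :=
  ∃ t : Fin d → Fˣ, ∀ g : UT d F,
    toMatrix (φ g) =
      diagonal (fun i => ((t i)⁻¹ : Fˣ).val) * toMatrix g * diagonal (fun i => (t i).val)

/-- The flip along the anti-diagonal: `x e_{i+1,i} ↦ x e_{d-i+1,d-i}`. -/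
def IsFlip (φ : MulAut (UT d F)) : Prop :=
  ∀ (i j : Fin d) (h : (i : ℕ) = j + 1) (x : F),
    φ (gen i j h x) = gen j.rev i.rev (by simp only [Fin.val_rev]; omega) x

variable (d F) in
/-- The inner automorphisms. -/
def innerAuts : Subgroup (MulAut (UT d F)) := (MulAut.conj : UT d F →* MulAut (UT d F)).range

variable (d F) in
/-- The central automorphisms: the centralizer of the inner automorphisms. -/
def centralAuts : Subgroup (MulAut (UT d F)) :=
  Subgroup.centralizer (innerAuts d F : Set (MulAut (UT d F)))

end UT

open scoped commutatorElement

namespace UT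

variable {d : ℕ} {F : Type*} [Field F]

/-! ### Matrix entries indexed by natural numbers -/

/-! Positions are counted from 0. The subgroups `Gam d F k`, matrices trivial above the `k`-th
subdiagonal, form a central series that every automorphism preserves. An automorphism `φ` is
improved by factors from `autGen` until it agrees with the identity on generators modulo the centre
`Gam d F (d - 1)`; it is then central.

On the first subdiagonal, the point is to recognise the individual entries. The centralizer of `Gam
d F (d - 2)` kills the entries `(1, 0)` and `(d - 1, d - 2)`. Inside it, the elements whose
commutator map on `Gam d F (d - 3)` is not onto form the union of two subgroups, which `φ` fixes or
exchanges (`map_CentHyp`). A flip undoes the exchange. Then each `Hyp d F k` is invariant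
(`IsUnflipped.mem_Hyp_of`), a diagonal automorphism sends the parameter 1 to 1, and the commutator
relation `E_commutator` turns the remaining action on parameters into a field automorphism
(`exists_level_two`).

Deeper down, if `φ` fixes the generators modulo `Gam d F (n + 1)`, the map `diff φ` is a derivation
on leading terms. The relations between commuting elementary matrices make nearly all leading
entries vanish (`Level.ent_eq_zero`). Those an inner automorphism could create come from a single
sequence, and one conjugation removes them (`Level.exists_reduced`). What survives concerns the
first and last generators only, on the subdiagonals `d - 3` and `d - 2`, and extremal automorphisms
remove it (`exists_killsFirst`).

On subdiagonal `d - 3`, a first-order relation shows that a surviving coefficient `c` satisfies `2c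
= 0`, and a second-order one that `c(x(x - 1))^2 = 0` for all `x`. So `F` has two elements, which
also proves the last claim. -/

/-- The entry of a square matrix at a pair of natural numbers, `0` outside of the matrix. -/
def ent (M : Matrix (Fin d) (Fin d) F) (i j : ℕ) : F :=
  if h : i < d ∧ j < d then M ⟨i, h.1⟩ ⟨j, h.2⟩ else 0

theorem ent_val (M : Matrix (Fin d) (Fin d) F) (i j : Fin d) : ent M i j = M i j := by
  simp [ent]

theorem ent_eq_zero_of_le (M : Matrix (Fin d) (Fin d) F) {i j : ℕ} (h : d ≤ i ∨ d ≤ j) :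
    ent M i j = 0 := by
  rw [ent, dif_neg (by omega)]

theorem ext_ent {M N : Matrix (Fin d) (Fin d) F} (h : ∀ i j, ent M i j = ent N i j) : M = N := by
  ext i j
  simpa only [ent_val] using h i j

@[simp] theorem ent_add (M N : Matrix (Fin d) (Fin d) F) (i j : ℕ) :
    ent (M + N) i j = ent M i j + ent N i j := by
  unfold ent; split_ifs <;> simp

@[simp] theorem ent_sub (M N : Matrix (Fin d) (Fin d) F) (i j : ℕ) :
    ent (M - N) i j = ent M i j - ent N i j := by
  unfold ent; split_ifs <;> simp

@[simp] theorem ent_neg (M : Matrix (Fin d) (Fin d) F) (i j : ℕ) :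
    ent (-M) i j = -ent M i j := by
  unfold ent; split_ifs <;> simp

@[simp] theorem ent_zero (i j : ℕ) : ent (0 : Matrix (Fin d) (Fin d) F) i j = 0 := by
  unfold ent; split_ifs <;> simp

theorem ent_mul (M N : Matrix (Fin d) (Fin d) F) (i j : ℕ) :
    ent (M * N) i j = ∑ k : Fin d, ent M i k * ent N k j := by
  unfold ent
  split_ifs with h
  · rw [Matrix.mul_apply]
    refine Finset.sum_congr rfl fun k _ => ?_
    rw [dif_pos ⟨h.1, k.2⟩, dif_pos ⟨k.2, h.2⟩]
  · symm
    refine Finset.sum_eq_zero fun k _ => ?_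
    by_cases hi : i < d
    · rw [dif_neg (c := (k : ℕ) < d ∧ j < d) (by omega), mul_zero]
    · rw [dif_neg (c := i < d ∧ (k : ℕ) < d) (by omega), zero_mul]

/-- A product entry to which only the index `m` contributes. -/
theorem ent_mul_eq_of_unique (M N : Matrix (Fin d) (Fin d) F) {i j : ℕ} (m : ℕ)
    (h : ∀ k, k ≠ m → ent M i k * ent N k j = 0) :
    ent (M * N) i j = ent M i m * ent N m j := by
  rw [ent_mul]
  by_cases hm : m < d
  · rw [Finset.sum_eq_single (⟨m, hm⟩ : Fin d)]
    · intro k _ hk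
      exact h k fun h' => hk (Fin.ext h')
    · simp
  · rw [ent_eq_zero_of_le M (Or.inr (not_lt.1 hm)), zero_mul]
    refine Finset.sum_eq_zero fun k _ => h k ?_
    have := k.2
    omega

/-- The matrix with `x` at position `(i, j)`, indexed by natural numbers, and `0` elsewhere. -/
def sgl (i j : ℕ) (x : F) : Matrix (Fin d) (Fin d) F :=
  Matrix.of fun a b => if (a : ℕ) = i ∧ (b : ℕ) = j then x else 0

theorem ent_sgl {i j : ℕ} (hi : i < d) (hj : j < d) (x : F) (a b : ℕ) :
    ent (sgl i j x : Matrix (Fin d) (Fin d) F) a b = if a = i ∧ b = j then x else 0 := by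
  unfold ent sgl
  split_ifs with h h' h' <;> simp_all

theorem ent_sgl_mul {i j : ℕ} (hi : i < d) (hj : j < d) (x : F) (M : Matrix (Fin d) (Fin d) F)
    (a b : ℕ) : ent (sgl i j x * M) a b = if a = i then x * ent M j b else 0 := by
  rw [ent_mul_eq_of_unique _ _ j, ent_sgl hi hj]
  · by_cases h : a = i <;> simp [h]
  · intro k hk
    rw [ent_sgl hi hj, if_neg (fun h => hk h.2), zero_mul]

theorem ent_mul_sgl {i j : ℕ} (hi : i < d) (hj : j < d) (x : F) (M : Matrix (Fin d) (Fin d) F)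
    (a b : ℕ) : ent (M * sgl i j x) a b = if b = j then ent M a i * x else 0 := by
  rw [ent_mul_eq_of_unique _ _ i, ent_sgl hi hj]
  · by_cases h : b = j <;> simp [h]
  · intro k hk
    rw [ent_sgl hi hj, if_neg (fun h => hk h.1), mul_zero]

theorem sgl_val (i j : Fin d) (x : F) : sgl (i : ℕ) (j : ℕ) x = single i j x := by
  ext a b
  simp [sgl, single_apply, Fin.ext_iff, eq_comm]

/-! ### The filtration by lower bands -/

variable (d F) in
/-- The matrices whose entries vanish above the `k`-th subdiagonal. -/
def band (k : ℕ) : AddSubgroup (Matrix (Fin d) (Fin d) F) where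
  carrier := {M | ∀ i j, i < j + k → ent M i j = 0}
  zero_mem' := by simp
  add_mem' := fun ha hb i j h => by simp [ha i j h, hb i j h]
  neg_mem' := fun ha i j h => by simp [ha i j h]

theorem band_anti {k l : ℕ} (h : k ≤ l) : band d F l ≤ band d F k :=
  fun _ hM i j hij => hM i j (by omega)

theorem mul_mem_band {k l : ℕ} {M N : Matrix (Fin d) (Fin d) F} (hM : M ∈ band d F k)
    (hN : N ∈ band d F l) : M * N ∈ band d F (k + l) := by
  intro i j hij
  rw [ent_mul]
  refine Finset.sum_eq_zero fun m _ => ?_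
  by_cases h : i < m + k
  · rw [hM i m h, zero_mul]
  · rw [hN m j (by omega), mul_zero]

theorem mul_mem_band' {k l n : ℕ} {M N : Matrix (Fin d) (Fin d) F} (hM : M ∈ band d F k)
    (hN : N ∈ band d F l) (h : n ≤ k + l) : M * N ∈ band d F n :=
  band_anti h (mul_mem_band hM hN)

theorem ent_mul_lead {k l : ℕ} {M N : Matrix (Fin d) (Fin d) F} (hM : M ∈ band d F k)
    (hN : N ∈ band d F l) (j : ℕ) :
    ent (M * N) (j + k + l) j = ent M (j + k + l) (j + l) * ent N (j + l) j := by
  refine ent_mul_eq_of_unique _ _ _ fun m hm => ?_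
  rcases lt_or_gt_of_ne hm with h | h
  · rw [hN m j h, mul_zero]
  · rw [hM _ m (by omega), zero_mul]

theorem eq_zero_of_mem_band {k : ℕ} (hk : d ≤ k) {M : Matrix (Fin d) (Fin d) F}
    (hM : M ∈ band d F k) : M = 0 := by
  refine ext_ent fun i j => ?_
  rw [ent_zero]
  by_cases h : i < d
  · exact hM i j (by omega)
  · exact ent_eq_zero_of_le M (by omega)

theorem mem_band_succ {k : ℕ} {M : Matrix (Fin d) (Fin d) F} (hM : M ∈ band d F k)
    (h : ∀ b, ent M (b + k) b = 0) : M ∈ band d F (k + 1) := by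
  intro i j hij
  by_cases h' : i < j + k
  · exact hM i j h'
  · obtain rfl : i = j + k := by omega
    exact h j

theorem sgl_mem_band {i j k : ℕ} (hi : i < d) (h : j + k ≤ i) (x : F) :
    sgl i j x ∈ band d F k := by
  intro a b hab
  rw [ent_sgl hi (by omega), if_neg (by omega)]

/-! ### Unitriangular matrices -/

theorem toMatrix_injective : Function.Injective (toMatrix : UT d F → _) :=
  fun _ _ h => Subtype.ext (Units.ext h)

@[simp] theorem toMatrix_mul (g h : UT d F) : toMatrix (g * h) = toMatrix g * toMatrix h := rfl

@[simp] theorem toMatrix_one : toMatrix (1 : UT d F) = 1 := rfl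

@[simp] theorem toMatrix_mul_inv (g : UT d F) : toMatrix g * toMatrix g⁻¹ = 1 := by
  rw [← toMatrix_mul, mul_inv_cancel, toMatrix_one]

@[simp] theorem toMatrix_inv_mul (g : UT d F) : toMatrix g⁻¹ * toMatrix g = 1 := by
  rw [← toMatrix_mul, inv_mul_cancel, toMatrix_one]

/-- The strictly lower triangular part of a unitriangular matrix. -/
def nil (g : UT d F) : Matrix (Fin d) (Fin d) F := toMatrix g - 1

theorem toMatrix_eq (g : UT d F) : toMatrix g = 1 + nil g := by simp [nil]

/-- The entries below the diagonal of a unitriangular matrix. -/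
def coef (g : UT d F) (i j : ℕ) : F := ent (nil g) i j

theorem nil_mem (g : UT d F) : nil g ∈ band d F 1 := by
  intro i j hij
  unfold ent nil
  split_ifs with h
  · rcases Nat.lt_or_ge i j with h' | h'
    · have := g.2.2 ⟨i, h.1⟩ ⟨j, h.2⟩ h'
      rw [Matrix.sub_apply, Matrix.one_apply_ne (Fin.ne_of_val_ne h'.ne)]
      simpa [toMatrix] using this
    · obtain rfl : i = j := by omega
      have := g.2.1 ⟨i, h.1⟩
      simpa [toMatrix, sub_eq_zero] using this
  · rfl

/-- A unitriangular matrix from its strictly lower triangular part. -/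
noncomputable def ofNil (M : Matrix (Fin d) (Fin d) F) (hM : M ∈ band d F 1) : UT d F :=
  ⟨Matrix.GeneralLinearGroup.mkOfDetNeZero (1 + M) (by
    rw [Matrix.det_of_isLowerTriangular, Finset.prod_eq_one]
    · exact one_ne_zero
    · intro i _
      have := hM i i (by omega)
      rw [ent_val] at this
      simp [this]
    · intro i j hij
      have hij' : i < j := hij
      have := hM i j (by omega)
      rw [ent_val] at this
      simp [this, hij'.ne]), by
    refine ⟨fun i => ?_, fun i j hij => ?_⟩
    · have := hM i i (by omega)
      rw [ent_val] at this
      change (1 + M) i i = 1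
      simp [this]
    · have := hM i j (by omega)
      rw [ent_val] at this
      change (1 + M) i j = 0
      simp [this, hij.ne]⟩

@[simp] theorem toMatrix_ofNil (M : Matrix (Fin d) (Fin d) F) (hM : M ∈ band d F 1) :
    toMatrix (ofNil M hM) = 1 + M := rfl

@[simp] theorem nil_ofNil (M : Matrix (Fin d) (Fin d) F) (hM : M ∈ band d F 1) :
    nil (ofNil M hM) = M := by
  simp [nil]

theorem nil_injective : Function.Injective (nil : UT d F → _) := fun g h e =>
  toMatrix_injective (by rw [toMatrix_eq, toMatrix_eq, e])

theorem ext_coef {g h : UT d F} (e : ∀ i j, coef g i j = coef h i j) : g = h :=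
  nil_injective (ext_ent e)

@[simp] theorem nil_one : nil (1 : UT d F) = 0 := by simp [nil]

@[simp] theorem coef_one (i j : ℕ) : coef (1 : UT d F) i j = 0 := by simp [coef]

theorem nil_mul (g h : UT d F) : nil (g * h) = nil g + nil h + nil g * nil h := by
  simp only [nil, toMatrix_mul]
  noncomm_ring

theorem coef_mul (g h : UT d F) (i j : ℕ) :
    coef (g * h) i j = coef g i j + coef h i j + ent (nil g * nil h) i j := by
  simp only [coef, nil_mul, ent_add]

theorem coef_eq_zero_of_lt (g : UT d F) {i j : ℕ} (h : i < j + 1) : coef g i j = 0 :=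
  nil_mem g i j h

theorem coef_eq_zero_of_le (g : UT d F) {i j : ℕ} (h : d ≤ i) : coef g i j = 0 :=
  ent_eq_zero_of_le _ (Or.inl h)

theorem toMatrix_mem_band (g : UT d F) : toMatrix g ∈ band d F 0 := by
  rw [toMatrix_eq]
  refine add_mem (fun i j hij => ?_) (band_anti zero_le_one (nil_mem g))
  unfold ent
  split_ifs with h
  · exact Matrix.one_apply_ne (Fin.ne_of_val_ne (by simp; omega))
  · rfl

theorem mul_toMatrix_mem {k : ℕ} {M : Matrix (Fin d) (Fin d) F} (hM : M ∈ band d F k)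
    (g : UT d F) : M * toMatrix g ∈ band d F k := mul_mem_band hM (toMatrix_mem_band g)

theorem toMatrix_mul_mem {k : ℕ} {M : Matrix (Fin d) (Fin d) F} (hM : M ∈ band d F k)
    (g : UT d F) : toMatrix g * M ∈ band d F k :=
  mul_mem_band' (toMatrix_mem_band g) hM (by omega)

theorem ent_mul_toMatrix_lead {k : ℕ} {M : Matrix (Fin d) (Fin d) F} (hM : M ∈ band d F k)
    (g : UT d F) (j : ℕ) : ent (M * toMatrix g) (j + k) j = ent M (j + k) j := by
  rw [toMatrix_eq, mul_add, mul_one, ent_add,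
    mul_mem_band hM (nil_mem g) _ _ (by omega), add_zero]

theorem ent_toMatrix_mul_lead {k : ℕ} {M : Matrix (Fin d) (Fin d) F} (hM : M ∈ band d F k)
    (g : UT d F) (j : ℕ) : ent (toMatrix g * M) (j + k) j = ent M (j + k) j := by
  rw [toMatrix_eq, add_mul, one_mul, ent_add,
    mul_mem_band (nil_mem g) hM _ _ (by omega), add_zero]

variable (d F) in
/-- The unitriangular matrices that are `0` strictly between the diagonal and the `k`-th
subdiagonal. -/
def Gam (k : ℕ) : Subgroup (UT d F) where
  carrier := {g | nil g ∈ band d F k}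
  one_mem' := by simp
  mul_mem' := by
    intro g h hg hh
    simp only [Set.mem_ofPred_eq, nil_mul] at *
    exact add_mem (add_mem hg hh) (mul_mem_band' hg hh (by omega))
  inv_mem' := by
    intro g hg
    have : nil g⁻¹ = -(nil g * toMatrix g⁻¹) := by
      simp only [nil, sub_mul, toMatrix_mul_inv]; simp
    simp only [Set.mem_ofPred_eq, this] at *
    exact neg_mem (mul_toMatrix_mem hg _)

theorem mem_Gam {k : ℕ} {g : UT d F} : g ∈ Gam d F k ↔ nil g ∈ band d F k := Iff.rfl

theorem mem_Gam_iff_coef {k : ℕ} {g : UT d F} :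
    g ∈ Gam d F k ↔ ∀ i j, i < j + k → coef g i j = 0 := Iff.rfl

theorem mem_Gam_one (g : UT d F) : g ∈ Gam d F 1 := nil_mem g

theorem Gam_anti {k l : ℕ} (h : k ≤ l) : Gam d F l ≤ Gam d F k := fun _ hg => band_anti h hg

theorem Gam_le_eq_one {k : ℕ} (hk : d ≤ k) {g : UT d F} (hg : g ∈ Gam d F k) : g = 1 :=
  nil_injective (by rw [eq_zero_of_mem_band hk hg, nil_one])

theorem mem_Gam_succ {k : ℕ} {g : UT d F} (hg : g ∈ Gam d F k) (h : ∀ b, coef g (b + k) b = 0) :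
    g ∈ Gam d F (k + 1) := mem_band_succ hg h

theorem coef_mul_lead {k : ℕ} {g h : UT d F} (hg : g ∈ Gam d F k) (hh : h ∈ Gam d F k)
    {i j : ℕ} (hij : i < j + (k + k)) : coef (g * h) i j = coef g i j + coef h i j := by
  rw [coef_mul, mul_mem_band hg hh _ _ hij, add_zero]

theorem coef_inv_lead {k : ℕ} {g : UT d F} (hg : g ∈ Gam d F k) {i j : ℕ}
    (hij : i < j + (k + k)) : coef g⁻¹ i j = -coef g i j := by
  have := coef_mul_lead hg (inv_mem hg) hij
  rw [mul_inv_cancel, coef_one] at this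
  exact (neg_eq_of_add_eq_zero_right this.symm).symm

theorem nil_commutator (g h : UT d F) :
    nil ⁅g, h⁆ = (nil g * nil h - nil h * nil g) * toMatrix (h * g)⁻¹ := by
  have h1 : ⁅g, h⁆ = g * h * (h * g)⁻¹ := by rw [commutatorElement_def]; group
  have h2 : nil g * nil h - nil h * nil g = toMatrix (g * h) - toMatrix (h * g) := by
    simp only [nil, toMatrix_mul]; noncomm_ring
  rw [h1, h2, nil, toMatrix_mul, sub_mul, toMatrix_mul_inv]

theorem nil_commutator_mul (g h : UT d F) :
    nil ⁅g, h⁆ * toMatrix (h * g) = nil g * nil h - nil h * nil g := by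
  rw [nil_commutator, mul_assoc, toMatrix_inv_mul, mul_one]

theorem commutator_mem_Gam {k l n : ℕ} {g h : UT d F} (hg : g ∈ Gam d F k) (hh : h ∈ Gam d F l)
    (hn : n ≤ k + l) : ⁅g, h⁆ ∈ Gam d F n := by
  rw [mem_Gam, nil_commutator]
  exact mul_toMatrix_mem (sub_mem (mul_mem_band' hg hh hn) (mul_mem_band' hh hg (by omega))) _

/-- The unitriangular factor in `nil_commutator` does not affect the first possibly nonzero
subdiagonal, so there the group commutator is the Lie bracket. -/
theorem coef_commutator {k l : ℕ} {g h : UT d F} (hg : g ∈ Gam d F k) (hh : h ∈ Gam d F l)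
    {i j u v : ℕ} (hi : i = j + k + l) (hu : u = j + l) (hv : v = j + k) :
    coef ⁅g, h⁆ i j = coef g i u * coef h u j - coef h i v * coef g v j := by
  subst hi hu hv
  have e : nil g * nil h - nil h * nil g ∈ band d F (k + l) :=
    sub_mem (mul_mem_band hg hh) (mul_mem_band' hh hg (by omega))
  have e1 := ent_mul_toMatrix_lead e (h * g)⁻¹ j
  have e2 := ent_mul_lead hh hg j
  rw [← nil_commutator, ← add_assoc] at e1
  rw [add_right_comm] at e2
  rw [coef, e1, ent_sub, ent_mul_lead hg hh, e2]
  rfl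

theorem conj_mem_Gam {k : ℕ} {g : UT d F} (hg : g ∈ Gam d F k) (h : UT d F) :
    h⁻¹ * g * h ∈ Gam d F k := by
  have : nil (h⁻¹ * g * h) = toMatrix h⁻¹ * nil g * toMatrix h := by
    simp only [nil, toMatrix_mul, mul_sub, sub_mul, mul_one, toMatrix_inv_mul]
  rw [mem_Gam, this]
  exact mul_toMatrix_mem (toMatrix_mul_mem hg _) _

/-! ### Elementary matrices -/

/-- The elementary matrix `1 + x e_{i,j}`, indexed by natural numbers. -/
noncomputable def E (i j : ℕ) (x : F) : UT d F :=
  if h : j < i ∧ i < d then ofNil (sgl i j x) (sgl_mem_band h.2 (by omega) x) else 1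

theorem nil_E {i j : ℕ} (hi : i < d) (hj : j < i) (x : F) :
    nil (E i j x : UT d F) = sgl i j x := by
  rw [E, dif_pos ⟨hj, hi⟩, nil_ofNil]

theorem coef_E {i j : ℕ} (hi : i < d) (hj : j < i) (x : F) (a b : ℕ) :
    coef (E i j x : UT d F) a b = if a = i ∧ b = j then x else 0 := by
  rw [coef, nil_E hi hj, ent_sgl hi (by omega)]

theorem coef_E_self {i j : ℕ} (hi : i < d) (hj : j < i) (x : F) :
    coef (E i j x : UT d F) i j = x := by
  rw [coef_E hi hj, if_pos ⟨rfl, rfl⟩]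

theorem coef_E_of_ne {i j : ℕ} (hi : i < d) (hj : j < i) (x : F) {a b : ℕ}
    (h : ¬(a = i ∧ b = j)) : coef (E i j x : UT d F) a b = 0 := by
  rw [coef_E hi hj, if_neg h]

theorem toMatrix_E {i j : ℕ} (hi : i < d) (hj : j < i) (x : F) :
    toMatrix (E i j x : UT d F) = 1 + sgl i j x := by
  rw [toMatrix_eq, nil_E hi hj]

theorem elem_eq_E (i j : Fin d) (h : j < i) (x : F) : elem i j h x = E i j x := by
  refine toMatrix_injective ?_
  rw [toMatrix_E i.2 h, sgl_val]
  rfl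

theorem gen_eq_E (i j : Fin d) (h : (i : ℕ) = j + 1) (x : F) : gen i j h x = E i j x :=
  elem_eq_E _ _ _ _

theorem E_mem_Gam {i j k : ℕ} (hi : i < d) (hj : j < i) (h : j + k ≤ i) (x : F) :
    (E i j x : UT d F) ∈ Gam d F k := by
  rw [mem_Gam, nil_E hi hj]
  exact sgl_mem_band hi h x

theorem sgl_mul_sgl {i j k l : ℕ} (hi : i < d) (hj : j < d) (hk : k < d) (hl : l < d) (x y : F) :
    (sgl i j x * sgl k l y : Matrix (Fin d) (Fin d) F) =
      if j = k then sgl i l (x * y) else 0 := by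
  refine ext_ent fun a b => ?_
  rw [ent_sgl_mul hi hj, ent_sgl hk hl]
  split_ifs with h1 h2 h2 <;> simp_all [ent_sgl]

theorem sgl_add (i j : ℕ) (x y : F) :
    (sgl i j (x + y) : Matrix (Fin d) (Fin d) F) = sgl i j x + sgl i j y := by
  ext a b
  simp only [sgl, of_apply, Matrix.add_apply]
  split_ifs <;> simp

@[simp] theorem sgl_zero (i j : ℕ) : (sgl i j 0 : Matrix (Fin d) (Fin d) F) = 0 := by
  ext a b
  simp [sgl]

theorem E_add {i j : ℕ} (hi : i < d) (hj : j < i) (x y : F) :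
    (E i j (x + y) : UT d F) = E i j x * E i j y := by
  refine nil_injective ?_
  rw [nil_mul, nil_E hi hj, nil_E hi hj, nil_E hi hj,
    sgl_mul_sgl hi (by omega) hi (by omega), if_neg hj.ne, sgl_add, add_zero]

@[simp] theorem E_zero (i j : ℕ) : (E i j 0 : UT d F) = 1 := by
  unfold E
  split_ifs with h
  · exact nil_injective (by simp)
  · rfl

theorem E_comm {i j p q : ℕ} (hi : i < d) (hj : j < i) (hp : p < d) (hq : q < p) (h1 : j ≠ p)
    (h2 : q ≠ i) (x y : F) : (E i j x * E p q y : UT d F) = E p q y * E i j x := by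
  refine nil_injective ?_
  rw [nil_mul, nil_mul, nil_E hi hj, nil_E hp hq,
    sgl_mul_sgl hi (by omega) hp (by omega), sgl_mul_sgl hp (by omega) hi (by omega),
    if_neg h1, if_neg h2, add_comm (sgl i j x)]

theorem E_commutator {i j k : ℕ} (hi : i < d) (hj : j < i) (hk : k < j) (x y : F) :
    ⁅(E i j x : UT d F), (E j k y : UT d F)⁆ = E i k (x * y) := by
  rw [commutatorElement_def, mul_inv_eq_iff_eq_mul, mul_inv_eq_iff_eq_mul]
  refine nil_injective ?_
  have hkd : k < d := by omega
  have hjd : j < d := by omega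
  have hki : k ≠ i := by omega
  simp only [nil_mul, nil_E hi hj, nil_E hjd hk, nil_E hi (hk.trans hj), add_mul,
    sgl_mul_sgl hi hjd hjd hkd, sgl_mul_sgl hi hkd hjd hkd, sgl_mul_sgl hi hkd hi hjd,
    sgl_mul_sgl hjd hkd hi hjd, zero_mul, hk.ne, hki,
    if_true, if_false]
  abel

/-- Induction over the subgroup `Gam d F k`, which is generated by elementary matrices. -/
theorem Gam_induction {P : UT d F → Prop} {k : ℕ} (hk : 1 ≤ k) (h1 : P 1)
    (hmul : ∀ g ∈ Gam d F k, ∀ h ∈ Gam d F k, P g → P h → P (g * h))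
    (hE : ∀ i j x, i < d → j + k ≤ i → P (E i j x)) : ∀ g ∈ Gam d F k, P g := by
  -- `n` bounds the number of subdiagonals left. In `inner`, one subdiagonal is cleared from right
  -- to left, splitting off an elementary factor for each column.
  have key : ∀ n l, k ≤ l → d ≤ l + n → ∀ g ∈ Gam d F l, P g := by
    intro n
    induction n with
    | zero =>
      intro l _ hl g hg
      rwa [Gam_le_eq_one hl hg]
    | succ n ih =>
      intro l hkl hl
      have inner : ∀ j, ∀ g ∈ Gam d F l, (∀ b, j ≤ b → coef g (b + l) b = 0) → P g := by
        intro j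
        induction j with
        | zero =>
          intro g hg h0
          exact ih (l + 1) (by omega) (by omega) g (mem_Gam_succ hg fun b => h0 b (Nat.zero_le b))
        | succ j ihj =>
          intro g hg h0
          by_cases hjd : j + l < d
          · have hEl : ∀ x : F, (E (j + l) j x : UT d F) ∈ Gam d F l := fun x =>
              E_mem_Gam hjd (by omega) le_rfl x
            have e : g = g * E (j + l) j (-coef g (j + l) j) * E (j + l) j (coef g (j + l) j) := by
              rw [mul_assoc, ← E_add hjd (by omega)]; simp
            have hm := mul_mem hg (hEl (-coef g (j + l) j))
            rw [e]
            refine hmul _ (Gam_anti hkl hm) _ (Gam_anti hkl (hEl _)) (ihj _ hm fun b hb => ?_)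
              (hE _ _ _ hjd (by omega))
            rw [coef_mul_lead hg (hEl _) (by omega), coef_E hjd (by omega)]
            by_cases hbj : b = j
            · subst hbj; simp
            · rw [if_neg (by omega), add_zero]
              exact h0 b (by omega)
          · refine ihj g hg fun b hb => coef_eq_zero_of_le g (by omega)
      intro g hg
      exact inner d g hg fun b hb => coef_eq_zero_of_le g (by omega)
  exact key d k le_rfl (by omega)

/-! ### Characteristic subgroups -/

theorem ent_bracket_E {p q : ℕ} (hp : p < d) (hq : q < p) (x : F) (g : UT d F) (a b : ℕ) :
    ent (nil g * nil (E p q x) - nil (E p q x) * nil g) a b =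
      (if b = q then coef g a p * x else 0) - if a = p then x * coef g q b else 0 := by
  rw [nil_E hp hq, ent_sub, ent_mul_sgl hp (by omega), ent_sgl_mul hp (by omega)]
  rfl

/-- This describes `Gam d F k` by commutators into `Gam d F (k + 1)`, so descending induction from
the trivial group makes all of them characteristic. For the converse, bracketing with a generator
moves the entry `(a, b)` to `(a + 1, b)` or, in the last row, to `(a, b - 1)`. -/
theorem mem_Gam_iff_commutator {k : ℕ} (hk : k + 1 ≤ d) (g : UT d F) :
    g ∈ Gam d F k ↔ ∀ h, ⁅g, h⁆ ∈ Gam d F (k + 1) := by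
  refine ⟨fun hg h => commutator_mem_Gam hg (mem_Gam_one h) le_rfl, fun H => ?_⟩
  rw [mem_Gam_iff_coef]
  intro a b hab
  have key : ∀ i, i + 1 < d → ∀ u v, u < v + (k + 1) →
      ((if v = i then coef g u (i + 1) * 1 else 0) -
        if u = i + 1 then 1 * coef g i v else 0) = 0 := by
    intro i hi u v huv
    rw [← ent_bracket_E hi (by omega), ← nil_commutator_mul]
    exact mul_toMatrix_mem (H _) _ u v huv
  by_cases hb : a ≤ b
  · exact coef_eq_zero_of_lt g (by omega)
  by_cases ha : a + 1 < d
  · have := key a ha (a + 1) b (by omega)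
    rw [if_neg (by omega), if_pos rfl] at this
    simpa using this
  · by_cases ha' : d ≤ a
    · exact coef_eq_zero_of_le g ha'
    · obtain ⟨c, rfl⟩ : ∃ c, b = c + 1 := ⟨b - 1, by omega⟩
      have := key c (by omega) a c (by omega)
      rw [if_neg (show a ≠ c + 1 by omega), if_pos rfl] at this
      simpa using this

theorem map_mem_Gam_aux (φ : MulAut (UT d F)) {k : ℕ} (hk : k ≤ d) (g : UT d F) :
    φ g ∈ Gam d F k ↔ g ∈ Gam d F k := by
  induction hk using Nat.decreasingInduction generalizing g with
  | self =>
    refine ⟨fun h => ?_, fun h => ?_⟩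
    · have := Gam_le_eq_one le_rfl h
      rw [EmbeddingLike.map_eq_one_iff] at this
      rw [this]; exact one_mem _
    · rw [Gam_le_eq_one le_rfl h, map_one]; exact one_mem _
  | of_succ k hk ih =>
    rw [mem_Gam_iff_commutator hk, mem_Gam_iff_commutator hk]
    constructor
    · intro H h
      rw [← ih, map_commutatorElement]
      exact H _
    · intro H h
      obtain ⟨h, rfl⟩ := φ.surjective h
      rw [← map_commutatorElement, ih]
      exact H h

theorem map_mem_Gam (φ : MulAut (UT d F)) (k : ℕ) (g : UT d F) :
    φ g ∈ Gam d F k ↔ g ∈ Gam d F k := by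
  rcases le_total k d with hk | hk
  · exact map_mem_Gam_aux φ hk g
  · have : Gam d F k = Gam d F d := by
      refine le_antisymm (Gam_anti hk) fun h hh => ?_
      rw [Gam_le_eq_one le_rfl hh]; exact one_mem _
    rw [this]
    exact map_mem_Gam_aux φ le_rfl g

/-! ### Recovering entries of the first subdiagonal, up to the flip. -/

variable (d F) in
/-- The unitriangular matrices with vanishing entry at `(b + 1, b)`. -/
def Hyp (b : ℕ) : Subgroup (UT d F) where
  carrier := {g | coef g (b + 1) b = 0}
  one_mem' := by simp
  mul_mem' := by
    intro g h hg hh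
    simp only [Set.mem_ofPred_eq] at *
    rw [coef_mul_lead (mem_Gam_one g) (mem_Gam_one h) (by omega), hg, hh, add_zero]
  inv_mem' := by
    intro g hg
    simp only [Set.mem_ofPred_eq] at *
    rw [coef_inv_lead (mem_Gam_one g) (by omega), hg, neg_zero]

theorem mem_Hyp {b : ℕ} {g : UT d F} : g ∈ Hyp d F b ↔ coef g (b + 1) b = 0 := Iff.rfl

/-- The commutator lies in `Gam d F (d - 1)`, where `(d - 1, 0)` is the only free entry. -/
theorem commutator_eq_one_iff_comm {g z : UT d F} {k l : ℕ} (hg : g ∈ Gam d F k)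
    (hz : z ∈ Gam d F l) (hkl : k + l + 1 = d) :
    g * z = z * g ↔ coef g (d - 1) l * coef z l 0 = coef z (d - 1) k * coef g k 0 := by
  have h1 : ⁅g, z⁆ ∈ Gam d F (d - 1) := commutator_mem_Gam hg hz (by omega)
  have h2 := coef_commutator hg hz (i := d - 1) (j := 0) (u := l) (v := k) (by omega) (by omega)
    (by omega)
  rw [← sub_eq_zero (a := coef g _ _ * _), ← h2, ← commutatorElement_eq_one_iff_mul_comm]
  refine ⟨fun h => by rw [h, coef_one], fun h => Gam_le_eq_one (k := d - 1 + 1) (by omega) ?_⟩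
  refine mem_Gam_succ h1 fun b => ?_
  rcases Nat.eq_zero_or_pos b with rfl | hb
  · simpa using h
  · exact coef_eq_zero_of_le _ (by omega)

/-- The centralizer of `Gam d F (d - 2)`. -/
theorem mem_cent_iff (hd : 5 ≤ d) (g : UT d F) :
    (g ∈ Hyp d F 0 ∧ g ∈ Hyp d F (d - 2)) ↔ ∀ z ∈ Gam d F (d - 2), g * z = z * g := by
  have e : d - 2 + 1 = d - 1 := by omega
  simp only [mem_Hyp, e]
  constructor
  · rintro ⟨h1, h2⟩ z hz
    rw [commutator_eq_one_iff_comm (mem_Gam_one g) hz (by omega), h2, h1]; simp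
  · intro H
    constructor
    · have hE := E_mem_Gam (d := d) (i := d - 1) (j := 1) (k := d - 2) (by omega) (by omega)
        (by omega) (1 : F)
      have := (commutator_eq_one_iff_comm (mem_Gam_one g) hE (by omega)).1 (H _ hE)
      rw [coef_E (by omega) (by omega), coef_E (by omega) (by omega), if_neg (by omega),
        if_pos ⟨rfl, rfl⟩] at this
      simpa using this.symm
    · have hE := E_mem_Gam (d := d) (i := d - 2) (j := 0) (k := d - 2) (by omega) (by omega)
        (by omega) (1 : F)
      have := (commutator_eq_one_iff_comm (mem_Gam_one g) hE (by omega)).1 (H _ hE)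
      rw [coef_E (by omega) (by omega), coef_E (by omega) (by omega), if_pos ⟨rfl, rfl⟩,
        if_neg (by omega)] at this
      simpa using this

theorem map_mem_cent (hd : 5 ≤ d) (φ : MulAut (UT d F)) (g : UT d F) :
    (φ g ∈ Hyp d F 0 ∧ φ g ∈ Hyp d F (d - 2)) ↔ (g ∈ Hyp d F 0 ∧ g ∈ Hyp d F (d - 2)) := by
  rw [mem_cent_iff hd, mem_cent_iff hd]
  constructor
  · intro H z hz
    have := H (φ z) ((map_mem_Gam φ _ z).2 hz)
    rw [← map_mul, ← map_mul] at this
    exact φ.injective this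
  · intro H z hz
    obtain ⟨z, rfl⟩ := φ.surjective z
    rw [← map_mul, H z ((map_mem_Gam φ _ z).1 hz), map_mul]

/-- Commutators with `g` map `Gam d F (d - 3)` onto `Gam d F (d - 2)`, modulo the center. -/
def IsFull (g : UT d F) : Prop :=
  ∀ z ∈ Gam d F (d - 2), ∃ h ∈ Gam d F (d - 3), z * ⁅g, h⁆ ∈ Gam d F (d - 1)

theorem map_isFull_of (φ : MulAut (UT d F)) {g : UT d F} (H : IsFull g) : IsFull (φ g) := by
  intro z hz
  obtain ⟨z, rfl⟩ := φ.surjective z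
  obtain ⟨h, hh, hz'⟩ := H z ((map_mem_Gam φ _ z).1 hz)
  refine ⟨φ h, (map_mem_Gam φ _ _).2 hh, ?_⟩
  rwa [← map_commutatorElement, ← map_mul, map_mem_Gam]

theorem map_isFull (φ : MulAut (UT d F)) (g : UT d F) : IsFull (φ g) ↔ IsFull g :=
  ⟨fun H => by simpa using map_isFull_of φ⁻¹ H, map_isFull_of φ⟩

theorem mem_Gam_sub_one_iff (hd : 5 ≤ d) {z : UT d F} (hz : z ∈ Gam d F (d - 2)) :
    z ∈ Gam d F (d - 1) ↔ coef z (d - 2) 0 = 0 ∧ coef z (d - 1) 1 = 0 := by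
  constructor
  · intro h
    exact ⟨h _ _ (by omega), h _ _ (by omega)⟩
  · rintro ⟨h0, h1⟩
    rw [show d - 1 = d - 2 + 1 by omega]
    refine mem_Gam_succ hz fun b => ?_
    rcases Nat.lt_or_ge 1 b with hb | hb
    · exact coef_eq_zero_of_le _ (by omega)
    · interval_cases b
      · simpa using h0
      · rw [show 1 + (d - 2) = d - 1 by omega]; exact h1

/-- For `g` in the centralizer the cross terms vanish. Modulo the centre, `h ↦ ⁅g, h⁆` then acts
separately on two entries of `h`, with the entries `(d - 2, d - 3)` and `(2, 1)` of `g` as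
multipliers, up to sign. -/
theorem coef_commutator_cent {g : UT d F} (hg : g ∈ Hyp d F 0 ∧ g ∈ Hyp d F (d - 2))
    (hd : 5 ≤ d) {z h : UT d F} (hz : z ∈ Gam d F (d - 2))
    (hh : h ∈ Gam d F (d - 3)) :
    z * ⁅g, h⁆ ∈ Gam d F (d - 1) ↔
      coef z (d - 2) 0 + coef g (d - 3 + 1) (d - 3) * coef h (d - 3) 0 = 0 ∧
      coef z (d - 1) 1 - coef h (d - 1) 2 * coef g (1 + 1) 1 = 0 := by
  have hc : ⁅g, h⁆ ∈ Gam d F (d - 2) := commutator_mem_Gam (mem_Gam_one g) hh (by omega)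
  obtain ⟨h1, h2⟩ := hg
  rw [mem_Hyp] at h1 h2
  rw [mem_Gam_sub_one_iff hd (mul_mem hz hc), coef_mul_lead hz hc (by omega),
    coef_mul_lead hz hc (by omega),
    coef_commutator (mem_Gam_one g) hh (i := d - 2) (j := 0) (u := d - 3) (v := 1) (by omega)
      (by omega) (by omega),
    coef_commutator (mem_Gam_one g) hh (i := d - 1) (j := 1) (u := d - 2) (v := 2) (by omega)
      (by omega) (by omega)]
  rw [show d - 2 + 1 = d - 1 by omega] at h2
  rw [zero_add] at h1
  rw [h1, h2, show d - 3 + 1 = d - 2 by omega]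
  simp [sub_eq_add_neg]

/-- The map is onto exactly when both multipliers are nonzero; the witnesses divide by them. -/
theorem isFull_iff {g : UT d F} (hg : g ∈ Hyp d F 0 ∧ g ∈ Hyp d F (d - 2)) (hd : 5 ≤ d) :
    ¬IsFull g ↔ g ∈ Hyp d F 1 ∨ g ∈ Hyp d F (d - 3) := by
  rw [mem_Hyp, mem_Hyp, ← not_iff_not, not_not, not_or]
  constructor
  · intro H
    constructor
    · intro h0
      have hE := E_mem_Gam (d := d) (i := d - 1) (j := 1) (k := d - 2) (by omega) (by omega)
        (by omega) (1 : F)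
      obtain ⟨h, hh, hz⟩ := H _ hE
      have := ((coef_commutator_cent hg hd hE hh).1 hz).2
      rw [h0, coef_E (by omega) (by omega), if_pos ⟨rfl, rfl⟩] at this
      simp at this
    · intro h0
      have hE := E_mem_Gam (d := d) (i := d - 2) (j := 0) (k := d - 2) (by omega) (by omega)
        (by omega) (1 : F)
      obtain ⟨h, hh, hz⟩ := H _ hE
      have := ((coef_commutator_cent hg hd hE hh).1 hz).1
      rw [h0, coef_E (by omega) (by omega), if_pos ⟨rfl, rfl⟩] at this
      simp at this
  · rintro ⟨n1, n2⟩ z hz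
    have hE1 : ∀ x : F, E (d - 3) 0 x ∈ Gam d F (d - 3) := fun x =>
      E_mem_Gam (by omega) (by omega) (by omega) x
    have hE2 : ∀ x : F, E (d - 1) 2 x ∈ Gam d F (d - 3) := fun x =>
      E_mem_Gam (by omega) (by omega) (by omega) x
    refine ⟨E (d - 3) 0 (-(coef g (d - 3 + 1) (d - 3))⁻¹ * coef z (d - 2) 0) *
      E (d - 1) 2 (coef z (d - 1) 1 * (coef g (1 + 1) 1)⁻¹), mul_mem (hE1 _) (hE2 _), ?_⟩
    rw [coef_commutator_cent hg hd hz (mul_mem (hE1 _) (hE2 _)),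
      coef_mul_lead (hE1 _) (hE2 _) (by omega), coef_mul_lead (hE1 _) (hE2 _) (by omega)]
    rw [coef_E_self (by omega) (by omega), coef_E_of_ne (by omega) (by omega) _ (by omega),
      coef_E_of_ne (by omega) (by omega) _ (by omega), coef_E_self (by omega) (by omega)]
    constructor <;> field_simp <;> ring

variable (d F) in
/-- The elements of the centralizer of `Gam d F (d - 2)` with vanishing entry at `(b + 1, b)`. -/
def CentHyp (b : ℕ) : Subgroup (UT d F) := Hyp d F 0 ⊓ Hyp d F (d - 2) ⊓ Hyp d F b

theorem mem_CentHyp {b : ℕ} {g : UT d F} :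
    g ∈ CentHyp d F b ↔ (g ∈ Hyp d F 0 ∧ g ∈ Hyp d F (d - 2)) ∧ g ∈ Hyp d F b := Iff.rfl

theorem map_mem_CentHyp_union (hd : 5 ≤ d) (φ : MulAut (UT d F)) (g : UT d F) :
    (φ g ∈ CentHyp d F 1 ∨ φ g ∈ CentHyp d F (d - 3)) ↔
      (g ∈ CentHyp d F 1 ∨ g ∈ CentHyp d F (d - 3)) := by
  have key : ∀ g : UT d F, (g ∈ CentHyp d F 1 ∨ g ∈ CentHyp d F (d - 3)) ↔
      (g ∈ Hyp d F 0 ∧ g ∈ Hyp d F (d - 2)) ∧ ¬IsFull g := by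
    intro g
    rw [mem_CentHyp, mem_CentHyp, ← and_or_left]
    exact and_congr_right fun hg => (isFull_iff hg hd).symm
  rw [key, key, map_isFull, map_mem_cent hd]

theorem E_mem_Hyp {i j b : ℕ} (hi : i < d) (hj : j < i) (h : ¬(b + 1 = i ∧ b = j)) (x : F) :
    E i j x ∈ Hyp d F b := by
  rw [mem_Hyp, coef_E hi hj, if_neg h]

theorem not_CentHyp_le (hd : 5 ≤ d) : ¬CentHyp d F 1 ≤ CentHyp d F (d - 3) := by
  intro H
  have h1 : E (d - 3 + 1) (d - 3) 1 ∈ CentHyp d F 1 := mem_CentHyp.2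
    ⟨⟨E_mem_Hyp (by omega) (by omega) (by omega) _, E_mem_Hyp (by omega) (by omega) (by omega) _⟩,
      E_mem_Hyp (by omega) (by omega) (by omega) _⟩
  have := mem_Hyp.1 (H h1).2
  rw [coef_E (by omega) (by omega), if_pos ⟨rfl, rfl⟩] at this
  exact one_ne_zero this

theorem not_CentHyp_ge (hd : 5 ≤ d) : ¬CentHyp d F (d - 3) ≤ CentHyp d F 1 := by
  intro H
  have h1 : E 2 1 1 ∈ CentHyp d F (d - 3) := mem_CentHyp.2
    ⟨⟨E_mem_Hyp (by omega) (by omega) (by omega) _, E_mem_Hyp (by omega) (by omega) (by omega) _⟩,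
      E_mem_Hyp (by omega) (by omega) (by omega) _⟩
  have := mem_Hyp.1 (H h1).2
  rw [coef_E (by omega) (by omega), if_pos ⟨rfl, rfl⟩] at this
  exact one_ne_zero this

/-- Two subgroups, neither of which contains the other, are determined by their union. -/
theorem _root_.Subgroup.eq_or_eq_of_union_eq {G : Type*} [Group G] {X Y X' Y' : Subgroup G}
    (h : (X : Set G) ∪ Y = (X' : Set G) ∪ Y') (h1 : ¬X ≤ Y) (h2 : ¬Y ≤ X) :
    (X = X' ∧ Y = Y') ∨ (X = Y' ∧ Y = X') := by
  have a1 := SubgroupClass.subset_union.1 (h ▸ Set.subset_union_left : (X : Set G) ⊆ X' ∪ Y')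
  have a2 := SubgroupClass.subset_union.1 (h ▸ Set.subset_union_right : (Y : Set G) ⊆ X' ∪ Y')
  have a3 := SubgroupClass.subset_union.1 (h ▸ Set.subset_union_left : (X' : Set G) ⊆ X ∪ Y)
  have a4 := SubgroupClass.subset_union.1 (h ▸ Set.subset_union_right : (Y' : Set G) ⊆ X ∪ Y)
  rcases a1 with a1 | a1 <;> rcases a2 with a2 | a2 <;> rcases a3 with a3 | a3 <;>
    rcases a4 with a4 | a4 <;>
    first
    | exact absurd (a1.trans a3) h1
    | exact absurd (a1.trans a4) h1
    | exact absurd (a2.trans a3) h2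
    | exact absurd (a2.trans a4) h2
    | exact Or.inl ⟨le_antisymm a1 a3, le_antisymm a2 a4⟩
    | exact Or.inr ⟨le_antisymm a1 a4, le_antisymm a2 a3⟩

/-- The union of the two subgroups is preserved and, as `d ≥ 5` gives `1 ≠ d - 3`, neither contains
the other. -/
theorem map_CentHyp (hd : 5 ≤ d) (φ : MulAut (UT d F)) :
    (∀ g, (φ g ∈ CentHyp d F 1 ↔ g ∈ CentHyp d F 1) ∧
      (φ g ∈ CentHyp d F (d - 3) ↔ g ∈ CentHyp d F (d - 3))) ∨
    (∀ g, (φ g ∈ CentHyp d F 1 ↔ g ∈ CentHyp d F (d - 3)) ∧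
      (φ g ∈ CentHyp d F (d - 3) ↔ g ∈ CentHyp d F 1)) := by
  have hs : ∀ X Y : Subgroup (UT d F),
      X.comap φ.toMonoidHom ≤ Y.comap φ.toMonoidHom → X ≤ Y := fun X Y h =>
    (Subgroup.comap_le_comap_of_surjective φ.surjective).1 h
  have := Subgroup.eq_or_eq_of_union_eq (X := (CentHyp d F 1).comap φ.toMonoidHom)
    (Y := (CentHyp d F (d - 3)).comap φ.toMonoidHom) (X' := CentHyp d F 1)
    (Y' := CentHyp d F (d - 3)) (Set.ext fun g => map_mem_CentHyp_union hd φ g)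
    (fun h => not_CentHyp_le hd (hs _ _ h)) (fun h => not_CentHyp_ge hd (hs _ _ h))
  refine this.imp (fun h g => ?_) (fun h g => ?_) <;>
    exact ⟨SetLike.ext_iff.1 h.1 g, SetLike.ext_iff.1 h.2 g⟩

/-! ### Automorphisms that do not flip preserve every `Hyp d F k`. -/

/-- `φ` preserves the two subgroups `CentHyp d F 1` and `CentHyp d F (d - 3)`. -/
def IsUnflipped (φ : MulAut (UT d F)) : Prop :=
  ∀ g, (φ g ∈ CentHyp d F 1 ↔ g ∈ CentHyp d F 1) ∧
    (φ g ∈ CentHyp d F (d - 3) ↔ g ∈ CentHyp d F (d - 3))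

theorem IsUnflipped.inv {φ : MulAut (UT d F)} (h : IsUnflipped φ) : IsUnflipped φ⁻¹ := by
  intro g
  have := h (φ⁻¹ g)
  rw [MulAut.apply_inv_self] at this
  exact ⟨this.1.symm, this.2.symm⟩

/-- The elements of `Gam d F k` whose `k`-th subdiagonal is supported in the first column. -/
def FirstCol (k : ℕ) (g : UT d F) : Prop := g ∈ Gam d F k ∧ ∀ b, 1 ≤ b → coef g (b + k) b = 0

/-- For `g` in `CentHyp d F 1` the multiplier of position `(d - 1, 1)` vanishes, so modulo the
centre these commutators fill exactly position `(d - 2, 0)`. -/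
theorem firstCol_top_iff (hd : 5 ≤ d) (z : UT d F) :
    FirstCol (d - 2) z ↔ z ∈ Gam d F (d - 2) ∧
      ∃ g ∈ CentHyp d F 1, ∃ h ∈ Gam d F (d - 3), z * ⁅g, h⁆ ∈ Gam d F (d - 1) := by
  refine and_congr_right fun hz => ⟨fun H => ?_, ?_⟩
  · have hg : E (d - 3 + 1) (d - 3) 1 ∈ CentHyp d F 1 := mem_CentHyp.2
      ⟨⟨E_mem_Hyp (by omega) (by omega) (by omega) _,
        E_mem_Hyp (by omega) (by omega) (by omega) _⟩,
        E_mem_Hyp (by omega) (by omega) (by omega) _⟩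
    have hh : E (d - 3) 0 (-coef z (d - 2) 0) ∈ Gam d F (d - 3) :=
      E_mem_Gam (by omega) (by omega) (by omega) _
    refine ⟨_, hg, _, hh, (coef_commutator_cent hg.1 hd hz hh).2 ⟨?_, ?_⟩⟩
    · rw [coef_E (by omega) (by omega), coef_E (by omega) (by omega), if_pos ⟨rfl, rfl⟩,
        if_pos ⟨rfl, rfl⟩]
      ring
    · have := H 1 le_rfl
      rw [show 1 + (d - 2) = d - 1 by omega] at this
      rw [coef_E (by omega) (by omega), if_neg (by omega), this]
      ring
  · rintro ⟨g, hg, h, hh, hc⟩ b hb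
    by_cases hb' : b = 1
    · have h1 := ((coef_commutator_cent hg.1 hd hz hh).1 hc).2
      rw [mem_Hyp.1 hg.2, mul_zero, sub_zero] at h1
      rwa [hb', show 1 + (d - 2) = d - 1 by omega]
    · exact coef_eq_zero_of_le _ (by omega)

theorem lastRow_top_iff (hd : 5 ≤ d) (z : UT d F) :
    (z ∈ Gam d F (d - 2) ∧ coef z (d - 2) 0 = 0) ↔ z ∈ Gam d F (d - 2) ∧
      ∃ g ∈ CentHyp d F (d - 3), ∃ h ∈ Gam d F (d - 3), z * ⁅g, h⁆ ∈ Gam d F (d - 1) := by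
  refine and_congr_right fun hz => ⟨fun H => ?_, ?_⟩
  · have hg : E (1 + 1) 1 1 ∈ CentHyp d F (d - 3) := mem_CentHyp.2
      ⟨⟨E_mem_Hyp (by omega) (by omega) (by omega) _,
        E_mem_Hyp (by omega) (by omega) (by omega) _⟩,
        E_mem_Hyp (by omega) (by omega) (by omega) _⟩
    have hh : E (d - 1) 2 (coef z (d - 1) 1) ∈ Gam d F (d - 3) :=
      E_mem_Gam (by omega) (by omega) (by omega) _
    refine ⟨_, hg, _, hh, (coef_commutator_cent hg.1 hd hz hh).2 ⟨?_, ?_⟩⟩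
    · rw [coef_E (i := d - 1) (by omega) (by omega), if_neg (by omega), H]
      ring
    · rw [coef_E (by omega) (by omega), coef_E (by omega) (by omega), if_pos ⟨rfl, rfl⟩,
        if_pos ⟨rfl, rfl⟩]
      ring
  · rintro ⟨g, hg, h, hh, hc⟩
    have h1 := ((coef_commutator_cent hg.1 hd hz hh).1 hc).1
    rwa [mem_Hyp.1 hg.2, zero_mul, add_zero] at h1

theorem IsUnflipped.lastRow_top (hd : 5 ≤ d) {φ : MulAut (UT d F)} (H : IsUnflipped φ)
    {z : UT d F} (hz : z ∈ Gam d F (d - 2) ∧ coef z (d - 2) 0 = 0) :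
    φ z ∈ Gam d F (d - 2) ∧ coef (φ z) (d - 2) 0 = 0 := by
  rw [lastRow_top_iff hd] at hz ⊢
  obtain ⟨hz, g, hg, h, hh, hc⟩ := hz
  refine ⟨(map_mem_Gam φ _ _).2 hz, φ g, (H g).2.2 hg, φ h, (map_mem_Gam φ _ _).2 hh, ?_⟩
  rwa [← map_commutatorElement, ← map_mul, map_mem_Gam]

theorem IsUnflipped.firstCol_top (hd : 5 ≤ d) {φ : MulAut (UT d F)} (H : IsUnflipped φ)
    {z : UT d F} (hz : FirstCol (d - 2) z) : FirstCol (d - 2) (φ z) := by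
  rw [firstCol_top_iff hd] at hz ⊢
  obtain ⟨hz, g, hg, h, hh, hc⟩ := hz
  refine ⟨(map_mem_Gam φ _ _).2 hz, φ g, (H g).1.2 hg, φ h, (map_mem_Gam φ _ _).2 hh, ?_⟩
  rwa [← map_commutatorElement, ← map_mul, map_mem_Gam]

/-- This carries invariance from subdiagonal `k + 1` to `k`. A forbidden entry `(b + k, b)` is moved
by a generator to `(b + k + 1, b)` or, in the last row, to `(b + k, b - 1)`. The latter is still
outside the first column because `k + 3 ≤ d`. -/
theorem firstCol_iff_commutator {k : ℕ} (hk : 1 ≤ k) (hkd : k + 3 ≤ d) (g : UT d F) :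
    FirstCol k g ↔ g ∈ Gam d F k ∧ ∀ h : UT d F, FirstCol (k + 1) ⁅g, h⁆ := by
  refine and_congr_right fun hg => ⟨fun H h => ⟨commutator_mem_Gam hg (mem_Gam_one h) le_rfl,
    fun b hb => ?_⟩, fun H b hb => ?_⟩
  · rw [coef_commutator hg (mem_Gam_one h) (u := b + 1) (v := b + k) (by omega) rfl rfl,
      H b hb, mul_zero, sub_zero, show b + (k + 1) = b + 1 + k by ring, H (b + 1) (by omega),
      zero_mul]
  · by_cases hbd : d ≤ b + k
    · exact coef_eq_zero_of_le _ hbd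
    by_cases hbd' : b + k + 1 < d
    · have := (H (E (b + k + 1) (b + k) 1 : UT d F)).2 b hb
      rw [coef_commutator hg (mem_Gam_one _) (u := b + 1) (v := b + k) (by omega) rfl rfl,
        coef_E (by omega) (by omega), coef_E (by omega) (by omega), if_neg (by omega),
        if_pos (by omega)] at this
      simpa using this
    · obtain ⟨c, rfl⟩ : ∃ c, b = c + 1 := ⟨b - 1, by omega⟩
      have := (H (E (c + 1) c 1)).2 c (by omega)
      rw [coef_commutator hg (mem_Gam_one _) (u := c + 1) (v := c + k) (by omega) rfl rfl,
        coef_E (by omega) (by omega), coef_E (by omega) (by omega), if_pos (by omega),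
        if_neg (by omega), show c + (k + 1) = c + 1 + k by ring] at this
      simpa using this

theorem IsUnflipped.firstCol (hd : 5 ≤ d) {φ : MulAut (UT d F)} (H : IsUnflipped φ) {k : ℕ}
    (hk : k ≤ d - 2) (hk1 : 1 ≤ k) {z : UT d F} (hz : FirstCol k z) : FirstCol k (φ z) := by
  induction hk using Nat.decreasingInduction generalizing z with
  | self => exact H.firstCol_top hd hz
  | of_succ k hk ih =>
    rw [firstCol_iff_commutator hk1 (by omega)] at hz ⊢
    refine ⟨(map_mem_Gam φ _ _).2 hz.1, fun h => ?_⟩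
    obtain ⟨h, rfl⟩ := φ.surjective h
    rw [← map_commutatorElement]
    exact ih (by omega) (hz.2 h)

/-- On subdiagonal `k + 1`, the commutator can only be nonzero at `(k + 1, 0)`, with value the
product of the entries `(k + 1, k)` of `g` and `(k, 0)` of `s`. -/
theorem mem_Hyp_iff_commutator {k : ℕ} (hk : 1 ≤ k) (hkd : k + 2 ≤ d) (g : UT d F) :
    g ∈ Hyp d F k ↔ ∀ s, FirstCol k s → ⁅g, s⁆ ∈ Gam d F (k + 2) := by
  rw [mem_Hyp]
  constructor
  · intro hg s hs
    refine mem_Gam_succ (k := k + 1) (commutator_mem_Gam (mem_Gam_one g) hs.1 (by omega))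
      fun b => ?_
    rw [coef_commutator (mem_Gam_one g) hs.1 (u := b + k) (v := b + 1) (by omega) rfl rfl,
      show b + (k + 1) = b + 1 + k by ring, hs.2 (b + 1) (by omega), zero_mul, sub_zero]
    rcases Nat.eq_zero_or_pos b with rfl | hb
    · rw [zero_add, add_comm 1 k, zero_add, hg, zero_mul]
    · rw [hs.2 b hb, mul_zero]
  · intro H
    have h1 : FirstCol k (E k 0 1 : UT d F) :=
      ⟨E_mem_Gam (by omega) (by omega) (by omega) _, fun b hb => by
        rw [coef_E (by omega) (by omega), if_neg (by omega)]⟩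
    have := mem_Gam_iff_coef.1 (H _ h1) (k + 1) 0 (by omega)
    rw [coef_commutator (mem_Gam_one g) h1.1 (u := k) (v := 1) (by omega) (by omega) (by omega),
      coef_E (by omega) (by omega), coef_E (by omega) (by omega), if_pos (by omega),
      if_neg (by omega)] at this
    simpa using this

/-- The first column cannot detect the entry `(1, 0)`; position `(d - 1, 1)` detects it instead. -/
theorem mem_Hyp_zero_iff (hd : 5 ≤ d) (g : UT d F) :
    g ∈ Hyp d F 0 ↔ ∀ z ∈ Gam d F (d - 2), coef z (d - 2) 0 = 0 → g * z = z * g := by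
  rw [mem_Hyp]
  constructor
  · intro hg z hz h0
    rw [commutator_eq_one_iff_comm (mem_Gam_one g) hz (by omega), h0, hg]; simp
  · intro H
    have hE := E_mem_Gam (d := d) (i := d - 1) (j := 1) (k := d - 2) (by omega) (by omega)
      (by omega) (1 : F)
    have h0 : coef (E (d - 1) 1 1 : UT d F) (d - 2) 0 = 0 := by
      rw [coef_E (by omega) (by omega), if_neg (by omega)]
    have := (commutator_eq_one_iff_comm (mem_Gam_one g) hE (by omega)).1 (H _ hE h0)
    rw [coef_E (by omega) (by omega), coef_E (by omega) (by omega), if_neg (by omega),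
      if_pos ⟨rfl, rfl⟩] at this
    simpa using this.symm

theorem IsUnflipped.mem_Hyp_of (hd : 5 ≤ d) {φ : MulAut (UT d F)} (H : IsUnflipped φ) {k : ℕ}
    {g : UT d F} (hg : g ∈ Hyp d F k) : φ g ∈ Hyp d F k := by
  by_cases hkd : k + 2 ≤ d
  · rcases Nat.eq_zero_or_pos k with rfl | hk
    · rw [mem_Hyp_zero_iff hd] at hg ⊢
      intro z hz h0
      have := H.inv.lastRow_top hd ⟨hz, h0⟩
      have h1 := congrArg φ (hg _ this.1 this.2)
      simpa using h1
    · rw [mem_Hyp_iff_commutator hk hkd] at hg ⊢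
      intro s hs
      have := hg _ (H.inv.firstCol hd (by omega) hk hs)
      rw [← map_mem_Gam φ, map_commutatorElement] at this
      simpa using this
  · exact coef_eq_zero_of_le _ (by omega)

/-! ### Flip, field and diagonal automorphisms -/

/-- The reflection of a matrix in the anti-diagonal, with signs. -/
def flipMatrix (M : Matrix (Fin d) (Fin d) F) : Matrix (Fin d) (Fin d) F :=
  Matrix.of fun i j => (-1) ^ ((i : ℕ) + j) * M j.rev i.rev

theorem ent_flipMatrix (M : Matrix (Fin d) (Fin d) F) {i j : ℕ} (hi : i < d) (hj : j < d) :
    ent (flipMatrix M) i j = (-1) ^ (i + j) * ent M (d - 1 - j) (d - 1 - i) := by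
  unfold ent flipMatrix
  rw [dif_pos ⟨hi, hj⟩, dif_pos (by omega), of_apply]
  congr 2 <;> ext <;> simp [Fin.val_rev] <;> omega

theorem flipMatrix_add (M N : Matrix (Fin d) (Fin d) F) :
    flipMatrix (M + N) = flipMatrix M + flipMatrix N := by
  ext i j
  simp [flipMatrix, mul_add]

theorem flipMatrix_mul (M N : Matrix (Fin d) (Fin d) F) :
    flipMatrix (M * N) = flipMatrix N * flipMatrix M := by
  ext i j
  simp only [flipMatrix, of_apply, mul_apply, Finset.mul_sum]
  rw [← Equiv.sum_comp Fin.revPerm]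
  refine Finset.sum_congr rfl fun k _ => ?_
  rw [Fin.revPerm_apply]
  have : ((-1 : F)) ^ ((i : ℕ) + k) * (-1) ^ ((k : ℕ) + j) = (-1) ^ ((i : ℕ) + j) := by
    rw [← pow_add, show (i : ℕ) + k + (k + j) = i + j + 2 * k by ring, pow_add, pow_mul]
    simp
  rw [← this]
  ring

theorem flipMatrix_flipMatrix (M : Matrix (Fin d) (Fin d) F) : flipMatrix (flipMatrix M) = M := by
  refine ext_ent fun i j => ?_
  by_cases h : i < d ∧ j < d
  · rw [ent_flipMatrix _ h.1 h.2, ent_flipMatrix _ (by omega) (by omega), ← mul_assoc, ← pow_add,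
      show i + j + (d - 1 - j + (d - 1 - i)) = 2 * (d - 1) by omega, pow_mul]
    rw [show d - 1 - (d - 1 - i) = i by omega, show d - 1 - (d - 1 - j) = j by omega]
    simp
  · rw [ent_eq_zero_of_le _ (by omega), ent_eq_zero_of_le _ (by omega)]

theorem flipMatrix_one : flipMatrix (1 : Matrix (Fin d) (Fin d) F) = 1 := by
  have := flipMatrix_mul (1 : Matrix (Fin d) (Fin d) F) (flipMatrix 1)
  rwa [one_mul, flipMatrix_flipMatrix, one_mul, eq_comm] at this

theorem flipMatrix_mem_band {k : ℕ} {M : Matrix (Fin d) (Fin d) F} (hM : M ∈ band d F k) :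
    flipMatrix M ∈ band d F k := by
  intro i j hij
  by_cases h : i < d ∧ j < d
  · rw [ent_flipMatrix _ h.1 h.2, hM _ _ (by omega), mul_zero]
  · exact ent_eq_zero_of_le _ (by omega)

/-- The reflection in the anti-diagonal, as a map on unitriangular matrices. -/
noncomputable def flipFun (g : UT d F) : UT d F :=
  -- Reflection and inversion both reverse products, so together they preserve them. On a generator,
  -- the sign `-1` of the reflection cancels the one from inversion.
  ofNil (flipMatrix (nil g⁻¹)) (flipMatrix_mem_band (nil_mem _))

theorem nil_flipFun (g : UT d F) : nil (flipFun g) = flipMatrix (nil g⁻¹) := nil_ofNil _ _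

theorem toMatrix_flipFun (g : UT d F) : toMatrix (flipFun g) = flipMatrix (toMatrix g⁻¹) := by
  rw [toMatrix_eq, nil_flipFun, toMatrix_eq, flipMatrix_add, flipMatrix_one]

theorem flipFun_mul (g h : UT d F) : flipFun (g * h) = flipFun g * flipFun h := by
  refine toMatrix_injective ?_
  rw [toMatrix_mul, toMatrix_flipFun, toMatrix_flipFun, toMatrix_flipFun, _root_.mul_inv_rev,
    toMatrix_mul, flipMatrix_mul]

variable (d F) in
/-- The reflection in the anti-diagonal, as an endomorphism. -/
noncomputable def flipHom : UT d F →* UT d F := MonoidHom.mk' flipFun flipFun_mul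

theorem flipHom_apply (g : UT d F) : flipHom d F g = flipFun g := rfl

theorem flipHom_flipHom (g : UT d F) : flipHom d F (flipHom d F g) = g := by
  refine toMatrix_injective ?_
  rw [flipHom_apply (flipHom d F g), toMatrix_flipFun, ← map_inv, flipHom_apply, toMatrix_flipFun,
    inv_inv, flipMatrix_flipMatrix]

variable (d F) in
/-- The flip automorphism. -/
noncomputable def flip : MulAut (UT d F) where
  toFun := flipHom d F
  invFun := flipHom d F
  left_inv := flipHom_flipHom
  right_inv := flipHom_flipHom
  map_mul' := map_mul _

theorem flip_flip (g : UT d F) : flip d F (flip d F g) = g := flipHom_flipHom g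

theorem nil_flip (g : UT d F) : nil (flip d F g) = flipMatrix (nil g⁻¹) := nil_flipFun g

theorem coef_flip {k : ℕ} {z : UT d F} (hz : z ∈ Gam d F k) {i j : ℕ} (hi : i < d) (hj : j < d)
    (hij : i < j + (k + k)) :
    coef (flip d F z) i j = -(-1) ^ (i + j) * coef z (d - 1 - j) (d - 1 - i) := by
  rw [coef, nil_flip, ent_flipMatrix _ hi hj]
  change _ * coef _ _ _ = _
  rw [coef_inv_lead hz (by omega)]
  ring

theorem coef_flip_eq_zero_iff {k : ℕ} {z : UT d F} (hz : z ∈ Gam d F k) {i j : ℕ} (hi : i < d)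
    (hj : j < d) (hij : i < j + (k + k)) :
    coef (flip d F z) i j = 0 ↔ coef z (d - 1 - j) (d - 1 - i) = 0 := by
  rw [coef_flip hz hi hj hij]
  simp

theorem E_inv {i j : ℕ} (hi : i < d) (hj : j < i) (x : F) : (E i j x : UT d F)⁻¹ = E i j (-x) := by
  rw [inv_eq_iff_mul_eq_one, ← E_add hi hj, add_neg_cancel, E_zero]

theorem flip_E {i : ℕ} (hi : i + 1 < d) (x : F) :
    flip d F (E (i + 1) i x) = E (d - 1 - i) (d - 1 - (i + 1)) x := by
  refine nil_injective (ext_ent fun a b => ?_)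
  rw [nil_flip, E_inv hi (by omega), nil_E hi (by omega), nil_E (by omega) (by omega),
    ent_sgl (by omega) (by omega)]
  by_cases h : a < d ∧ b < d
  · rw [ent_flipMatrix _ h.1 h.2, ent_sgl hi (by omega)]
    by_cases hab : a = d - 1 - i ∧ b = d - 1 - (i + 1)
    · rw [if_pos hab, if_pos (by omega), Odd.neg_one_pow]
      · ring
      · rw [hab.1, hab.2]
        exact ⟨d - 1 - (i + 1), by omega⟩
    · rw [if_neg hab, if_neg (by omega), mul_zero]
  · rw [ent_eq_zero_of_le _ (by omega), if_neg (by omega)]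

theorem isFlip_flip : IsFlip (flip d F) := by
  intro i j h x
  rw [gen_eq_E, gen_eq_E, h, flip_E (by omega)]
  congr 1 <;> simp only [Fin.val_rev] <;> omega

/-! ### Automorphisms induced by ring automorphisms of the matrix algebra. -/

/-- The automorphism of the unitriangular group defined by a ring automorphism of the matrix
ring. -/
noncomputable def liftRingEquiv
    (f : Matrix (Fin d) (Fin d) F ≃+* Matrix (Fin d) (Fin d) F)
    (hf : ∀ M ∈ band d F 1, f M ∈ band d F 1) (hf' : ∀ M ∈ band d F 1, f.symm M ∈ band d F 1) :
    MulAut (UT d F) where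
  toFun g := ofNil (f (nil g)) (hf _ (nil_mem g))
  invFun g := ofNil (f.symm (nil g)) (hf' _ (nil_mem g))
  left_inv g := nil_injective (by simp)
  right_inv g := nil_injective (by simp)
  map_mul' g h := nil_injective (by simp [nil_mul])

theorem nil_liftRingEquiv (f : Matrix (Fin d) (Fin d) F ≃+* Matrix (Fin d) (Fin d) F)
    (hf : ∀ M ∈ band d F 1, f M ∈ band d F 1) (hf' : ∀ M ∈ band d F 1, f.symm M ∈ band d F 1)
    (g : UT d F) : nil (liftRingEquiv f hf hf' g) = f (nil g) := nil_ofNil _ (hf _ (nil_mem g))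

theorem ent_mapMatrix (μ : F ≃+* F) (M : Matrix (Fin d) (Fin d) F) (i j : ℕ) :
    ent (μ.mapMatrix M) i j = μ (ent M i j) := by
  unfold ent
  split_ifs <;> simp

theorem mapMatrix_mem_band (μ : F ≃+* F) (M : Matrix (Fin d) (Fin d) F) (hM : M ∈ band d F 1) :
    μ.mapMatrix M ∈ band d F 1 := by
  intro i j hij
  rw [ent_mapMatrix, hM i j hij, map_zero]

theorem mapMatrix_symm_mem_band (μ : F ≃+* F) (M : Matrix (Fin d) (Fin d) F)
    (hM : M ∈ band d F 1) : μ.mapMatrix.symm M ∈ band d F 1 :=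
  mapMatrix_mem_band μ.symm M hM

variable (d) in
/-- The automorphism applying a field automorphism to all entries. -/
noncomputable def fieldAut (μ : F ≃+* F) : MulAut (UT d F) :=
  liftRingEquiv μ.mapMatrix (mapMatrix_mem_band μ) (mapMatrix_symm_mem_band μ)

theorem coef_fieldAut (μ : F ≃+* F) (g : UT d F) (i j : ℕ) :
    coef (fieldAut d μ g) i j = μ (coef g i j) := by
  rw [coef, fieldAut, nil_liftRingEquiv, ent_mapMatrix]
  rfl

theorem isFieldAut_fieldAut (μ : F ≃+* F) : IsFieldAut (fieldAut d μ) := by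
  refine ⟨μ, fun i j h x => ext_coef fun a b => ?_⟩
  rw [coef_fieldAut, gen_eq_E, gen_eq_E, coef_E i.2 (by omega), coef_E i.2 (by omega)]
  split_ifs <;> simp

variable (d) in
/-- Conjugation of matrices by an invertible diagonal matrix. -/
noncomputable def diagConj (t : ℕ → Fˣ) :
    Matrix (Fin d) (Fin d) F ≃+* Matrix (Fin d) (Fin d) F where
  toFun M := diagonal (fun i : Fin d => ((t i)⁻¹ : Fˣ).val) * M *
    diagonal (fun i : Fin d => (t i).val)
  invFun M := diagonal (fun i : Fin d => (t i).val) * M *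
    diagonal (fun i : Fin d => ((t i)⁻¹ : Fˣ).val)
  left_inv M := by ext i j; simp [mul_diagonal, diagonal_mul, mul_assoc]
  right_inv M := by ext i j; simp [mul_diagonal, diagonal_mul, mul_assoc]
  map_add' M N := by simp [mul_add, add_mul]
  map_mul' M N := by
    have h : diagonal (fun i : Fin d => (t i).val) *
        diagonal (fun i : Fin d => ((t i)⁻¹ : Fˣ).val) = 1 := by
      rw [diagonal_mul_diagonal]; simp
    simp only [mul_assoc]
    rw [← mul_assoc (diagonal fun i : Fin d => (t i).val) (diagonal _), h, one_mul]

theorem ent_diagConj (t : ℕ → Fˣ) (M : Matrix (Fin d) (Fin d) F) (i j : ℕ) :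
    ent (diagConj d t M) i j = ((t i)⁻¹ : Fˣ).val * ent M i j * (t j).val := by
  unfold ent diagConj
  split_ifs <;> simp [mul_diagonal, diagonal_mul]

theorem ent_diagConj_symm (t : ℕ → Fˣ) (M : Matrix (Fin d) (Fin d) F) (i j : ℕ) :
    ent ((diagConj d t).symm M) i j = (t i).val * ent M i j * ((t j)⁻¹ : Fˣ).val := by
  unfold ent
  split_ifs
  · change (diagonal _ * M * diagonal _ : Matrix _ _ F) _ _ = _
    simp [mul_diagonal, diagonal_mul]
  · simp

theorem diagConj_mem_band (t : ℕ → Fˣ) (M : Matrix (Fin d) (Fin d) F) (hM : M ∈ band d F 1) :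
    diagConj d t M ∈ band d F 1 := fun i j hij => by rw [ent_diagConj, hM i j hij]; simp

theorem diagConj_symm_mem_band (t : ℕ → Fˣ) (M : Matrix (Fin d) (Fin d) F)
    (hM : M ∈ band d F 1) : (diagConj d t).symm M ∈ band d F 1 := fun i j hij => by
  rw [ent_diagConj_symm, hM i j hij]; simp

variable (d) in
/-- Conjugation by an invertible diagonal matrix. -/
noncomputable def diagAut (t : ℕ → Fˣ) : MulAut (UT d F) :=
  liftRingEquiv (diagConj d t) (diagConj_mem_band t) (diagConj_symm_mem_band t)

theorem coef_diagAut (t : ℕ → Fˣ) (g : UT d F) (i j : ℕ) :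
    coef (diagAut d t g) i j = ((t i)⁻¹ : Fˣ).val * coef g i j * (t j).val := by
  rw [coef, diagAut, nil_liftRingEquiv, ent_diagConj]
  rfl

theorem isDiagonalAut_diagAut (t : ℕ → Fˣ) : IsDiagonalAut (diagAut d t) := by
  refine ⟨fun i => t i, fun g => ?_⟩
  change _ = diagConj d t (toMatrix g)
  rw [toMatrix_eq, toMatrix_eq, diagAut, nil_liftRingEquiv, map_add, map_one]

/-! ### Extremal automorphisms -/

/-- The unitriangular matrix with entries `a`, `b`, `c` at the beginning of the last row. -/
noncomputable def lastRow (hd : 5 ≤ d) (a b c : F) : UT d F :=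
  ofNil (sgl (d - 1) 0 a + sgl (d - 1) 1 b + sgl (d - 1) 2 c)
    (add_mem (add_mem (sgl_mem_band (by omega) (by omega) _) (sgl_mem_band (by omega) (by omega) _))
      (sgl_mem_band (by omega) (by omega) _))

section lastRow
variable (hd : 5 ≤ d)

theorem nil_lastRow (a b c : F) :
    nil (lastRow hd a b c) = sgl (d - 1) 0 a + sgl (d - 1) 1 b + sgl (d - 1) 2 c := nil_ofNil _ _

theorem coef_lastRow (a b c : F) (i j : ℕ) : coef (lastRow hd a b c) i j =
    if i = d - 1 then (if j = 0 then a else if j = 1 then b else if j = 2 then c else 0) else 0 := by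
  rw [coef, nil_lastRow, ent_add, ent_add, ent_sgl (by omega) (by omega),
    ent_sgl (by omega) (by omega), ent_sgl (by omega) (by omega)]
  by_cases hi : i = d - 1
  · by_cases h0 : j = 0
    · subst h0; simp
    by_cases h1 : j = 1
    · subst h1; simp
    · by_cases h2 : j = 2 <;> simp [hi, h0, h1, h2]
  · simp [hi]

theorem nil_mul_nil_lastRow (g : UT d F) (a b c : F) : nil g * nil (lastRow hd a b c) = 0 := by
  refine ext_ent fun i j => ?_
  have h : ∀ i, ent (nil g) i (d - 1) = 0 := fun i => by
    by_cases hi : i < d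
    · exact nil_mem g i (d - 1) (by omega)
    · exact ent_eq_zero_of_le _ (by omega)
  rw [nil_lastRow, mul_add, mul_add, ent_add, ent_add, ent_mul_sgl (by omega) (by omega),
    ent_mul_sgl (by omega) (by omega), ent_mul_sgl (by omega) (by omega), h]
  simp

theorem coef_mul_lastRow (g : UT d F) (a b c : F) (i j : ℕ) :
    coef (g * lastRow hd a b c) i j = coef g i j + coef (lastRow hd a b c) i j := by
  rw [coef_mul, nil_mul_nil_lastRow, ent_zero, add_zero]

theorem lastRow_mem {a b c : F} {k : ℕ} (hk : k + 3 ≤ d ∨ k + 2 ≤ d ∧ c = 0) :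
    lastRow hd a b c ∈ Gam d F k := by
  rw [mem_Gam_iff_coef]
  intro i j hij
  rw [coef_lastRow]
  split_ifs <;> first | rfl | omega | exact (hk.resolve_left (by omega)).2

theorem lastRow_mul_lastRow (a b c a' b' c' : F) :
    lastRow hd a b c * lastRow hd a' b' c' = lastRow hd (a + a') (b + b') (c + c') := by
  refine ext_coef fun i j => ?_
  rw [coef_mul_lastRow, coef_lastRow, coef_lastRow, coef_lastRow]
  split_ifs <;> simp

theorem lastRow_zero : lastRow hd (0 : F) 0 0 = 1 :=
  nil_injective (by rw [nil_lastRow]; simp)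

theorem lastRow_mul (h : UT d F) (a b c : F) : lastRow hd a b c * h =
    h * lastRow hd (a + b * coef h 1 0 + c * coef h 2 0) (b + c * coef h 2 1) c := by
  refine ext_coef fun i j => ?_
  rw [coef_mul_lastRow, coef_mul, nil_lastRow, add_mul, add_mul, ent_add, ent_add,
    ent_sgl_mul (by omega) (by omega), ent_sgl_mul (by omega) (by omega),
    ent_sgl_mul (by omega) (by omega), coef_lastRow, coef_lastRow]
  change _ + (((if i = d - 1 then a * coef h 0 j else 0) + if i = d - 1 then b * coef h 1 j else 0)
    + if i = d - 1 then c * coef h 2 j else 0) = _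
  have hlt : ∀ i j, i < j + 1 → coef h i j = 0 := fun i j => coef_eq_zero_of_lt h
  by_cases hi : i = d - 1
  · simp only [hi, if_true, hlt 0 j (by omega)]
    by_cases h0 : j = 0
    · subst h0; simp; ring
    by_cases h1 : j = 1
    · subst h1; simp [hlt 1 1]; ring
    by_cases h2 : j = 2
    · subst h2; simp [hlt 1 2, hlt 2 2]; ring
    · simp [h0, h1, h2, hlt 1 j (by omega), hlt 2 j (by omega)]
  · simp [hi]

/-- The automorphism `g ↦ g * z g` defined by a `1`-cocycle `z` with values in the last row. -/
noncomputable def cocycleAut (r0 r1 r2 : UT d F → F)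
    -- `h0`, `h1`, `h2` are the cocycle identity for the action in `lastRow_mul`. By `i0`, `i1`,
    -- `i2` the cocycle does not see last-row factors, so negating it gives the inverse map.
    (h0 : ∀ g h, r0 (g * h) = r0 g + r1 g * coef h 1 0 + r2 g * coef h 2 0 + r0 h)
    (h1 : ∀ g h, r1 (g * h) = r1 g + r2 g * coef h 2 1 + r1 h)
    (h2 : ∀ g h, r2 (g * h) = r2 g + r2 h)
    (i0 : ∀ g a b c, r0 (g * lastRow hd a b c) = r0 g)
    (i1 : ∀ g a b c, r1 (g * lastRow hd a b c) = r1 g)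
    (i2 : ∀ g a b c, r2 (g * lastRow hd a b c) = r2 g) : MulAut (UT d F) where
  toFun g := g * lastRow hd (r0 g) (r1 g) (r2 g)
  invFun g := g * lastRow hd (-r0 g) (-r1 g) (-r2 g)
  left_inv g := by
    simp only [i0, i1, i2]
    rw [mul_assoc, lastRow_mul_lastRow]; simp [lastRow_zero]
  right_inv g := by
    simp only [i0, i1, i2]
    rw [mul_assoc, lastRow_mul_lastRow]; simp [lastRow_zero]
  map_mul' g h := by
    rw [h0, h1, h2, ← lastRow_mul_lastRow, mul_assoc g, mul_assoc g, ← mul_assoc h, ← lastRow_mul,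
      mul_assoc]

theorem coef_mul_one_zero (g h : UT d F) : coef (g * h) 1 0 = coef g 1 0 + coef h 1 0 :=
  coef_mul_lead (mem_Gam_one g) (mem_Gam_one h) (by omega)

theorem coef_mul_two_one (g h : UT d F) : coef (g * h) 2 1 = coef g 2 1 + coef h 2 1 :=
  coef_mul_lead (mem_Gam_one g) (mem_Gam_one h) (by omega)

theorem coef_mul_two_zero (g h : UT d F) :
    coef (g * h) 2 0 = coef g 2 0 + coef h 2 0 + coef g 2 1 * coef h 1 0 := by
  rw [coef_mul]
  congr 1
  exact ent_mul_lead (nil_mem g) (nil_mem h) 0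

theorem coef_mul_lastRow_of_lt (g : UT d F) (a b c : F) {i j : ℕ} (hi : i < 3) :
    coef (g * lastRow hd a b c) i j = coef g i j := by
  rw [coef_mul_lastRow, coef_lastRow, if_neg (by omega), add_zero]

/-- The first kind of extremal automorphisms in characteristic different from `2`. -/
noncomputable def extremalOdd (a : F) (lam : F → F)
    (hl : ∀ x y, lam (x + y) - lam x - lam y = a * x * y) : MulAut (UT d F) :=
  cocycleAut hd (fun g => lam (coef g 1 0)) (fun g => a * coef g 1 0) (fun _ => 0)
    (fun g h => by
      rw [coef_mul_one_zero]
      linear_combination hl (coef g 1 0) (coef h 1 0))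
    (fun g h => by rw [coef_mul_one_zero]; ring) (fun g h => by ring)
    (fun g a b c => by rw [coef_mul_lastRow_of_lt hd g a b c (by omega)])
    (fun g a b c => by rw [coef_mul_lastRow_of_lt hd g a b c (by omega)]) (fun _ _ _ _ => rfl)

theorem extremalOdd_apply (a : F) (lam : F → F)
    (hl : ∀ x y, lam (x + y) - lam x - lam y = a * x * y) (g : UT d F) :
    extremalOdd hd a lam hl g = g * lastRow hd (lam (coef g 1 0)) (a * coef g 1 0) 0 := rfl

/-- The first kind of extremal automorphisms over the field with two elements. -/
noncomputable def extremalEven (h2 : (2 : F) = 0) (hF : ∀ x : F, x = 0 ∨ x = 1) :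
    MulAut (UT d F) :=
  -- The identity for `r1` needs only `2 = 0`; the one for `r0` also needs `x * x = x`.
  cocycleAut hd (fun g => coef g 1 0 * coef g 2 0 + coef g 2 0)
    (fun g => coef g 1 0 * coef g 2 1 + coef g 2 0) (fun g => coef g 1 0)
    (fun g h => by
      have : coef h 1 0 * coef h 1 0 = coef h 1 0 := by
        rcases hF (coef h 1 0) with h | h <;> simp [h]
      rw [coef_mul_one_zero, coef_mul_two_zero]
      linear_combination coef g 2 1 * this + coef g 2 1 * coef h 1 0 * h2)
    (fun g h => by
      rw [coef_mul_one_zero, coef_mul_two_zero, coef_mul_two_one]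
      linear_combination coef g 2 1 * coef h 1 0 * h2)
    (fun g h => coef_mul_one_zero g h)
    (fun g a b c => by simp only [coef_mul_lastRow_of_lt hd g a b c (show 1 < 3 by omega),
      coef_mul_lastRow_of_lt hd g a b c (show 2 < 3 by omega)])
    (fun g a b c => by simp only [coef_mul_lastRow_of_lt hd g a b c (show 1 < 3 by omega),
      coef_mul_lastRow_of_lt hd g a b c (show 2 < 3 by omega)])
    (fun g a b c => by simp only [coef_mul_lastRow_of_lt hd g a b c (show 1 < 3 by omega)])

theorem extremalEven_apply (h2 : (2 : F) = 0) (hF : ∀ x : F, x = 0 ∨ x = 1) (g : UT d F) :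
    extremalEven hd h2 hF g = g * lastRow hd (coef g 1 0 * coef g 2 0 + coef g 2 0)
      (coef g 1 0 * coef g 2 1 + coef g 2 0) (coef g 1 0) := rfl

theorem toMatrix_E_mul_lastRow (x a b c : F) :
    toMatrix (E 1 0 x * lastRow hd a b c) = 1 + single (i₂ hd) (i₁ hd) x +
      (single (i₁ hd).rev (i₁ hd) a + single (i₁ hd).rev (i₂ hd) b +
        single (i₁ hd).rev (i₃ hd) c) := by
  rw [toMatrix_eq, nil_mul, nil_mul_nil_lastRow, add_zero, nil_lastRow, ← sgl_val, ← sgl_val,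
    ← sgl_val, ← sgl_val, nil_E (by omega) (by omega), ← add_assoc]
  simp only [i₁, i₂, i₃, Fin.val_rev, zero_add]

theorem fixesOtherGens_of {φ : MulAut (UT d F)} {p q : Fin d}
    (h : ∀ i, i + 1 < d → i ≠ q → ∀ x : F, φ (E (i + 1) i x) = E (i + 1) i x)
    (hpq : (p : ℕ) = q + 1) : FixesOtherGens φ p q := by
  intro i j hij hne x
  rw [gen_eq_E, hij]
  refine h _ (by omega) (fun e => hne ?_) x
  rw [Prod.mk.injEq]
  exact ⟨Fin.ext (by omega), Fin.ext (by omega)⟩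

theorem coef_gen_eq_zero {i : ℕ} (hi : i + 1 < d) (hi0 : i ≠ 0) (x : F) :
    coef (E (i + 1) i x : UT d F) 1 0 = 0 ∧ coef (E (i + 1) i x : UT d F) 2 0 = 0 :=
  ⟨coef_E_of_ne hi (by omega) _ (by omega), coef_E_of_ne hi (by omega) _ (by omega)⟩

theorem extremalOdd_gen (a : F) (lam : F → F)
    (hl : ∀ x y, lam (x + y) - lam x - lam y = a * x * y) {i : ℕ} (hi : i + 1 < d) (hi0 : i ≠ 0)
    (x : F) : extremalOdd hd a lam hl (E (i + 1) i x) = E (i + 1) i x := by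
  rw [extremalOdd_apply, (coef_gen_eq_zero hi hi0 x).1]
  have h0 : lam 0 = 0 := by simpa using hl 0 0
  rw [h0, mul_zero, lastRow_zero, mul_one]

theorem extremalOdd_first (a : F) (lam : F → F)
    (hl : ∀ x y, lam (x + y) - lam x - lam y = a * x * y) (x : F) :
    extremalOdd hd a lam hl (E 1 0 x) = E 1 0 x * lastRow hd (lam x) (a * x) 0 := by
  rw [extremalOdd_apply, coef_E_self (by omega) (by omega)]

theorem extremalEven_gen (h2 : (2 : F) = 0) (hF : ∀ x : F, x = 0 ∨ x = 1) {i : ℕ}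
    (hi : i + 1 < d) (hi0 : i ≠ 0) (x : F) :
    extremalEven hd h2 hF (E (i + 1) i x) = E (i + 1) i x := by
  rw [extremalEven_apply, (coef_gen_eq_zero hi hi0 x).1, (coef_gen_eq_zero hi hi0 x).2]
  simp [lastRow_zero]

theorem extremalEven_first (h2 : (2 : F) = 0) (hF : ∀ x : F, x = 0 ∨ x = 1) (x : F) :
    extremalEven hd h2 hF (E 1 0 x) = E 1 0 x * lastRow hd 0 0 x := by
  rw [extremalEven_apply, coef_E_self (by omega) (by omega),
    coef_E_of_ne (a := 2) (b := 0) (by omega) (by omega) _ (by omega),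
    coef_E_of_ne (a := 2) (b := 1) (by omega) (by omega) _ (by omega)]
  simp

theorem isExtremalOdd_extremalOdd (a : F) (lam : F → F)
    (hl : ∀ x y, lam (x + y) - lam x - lam y = a * x * y) :
    IsExtremalOdd hd (extremalOdd hd a lam hl) := by
  refine ⟨a, lam, hl, Or.inl ⟨fun x => ?_,
    fixesOtherGens_of (fun i hi hi0 x => extremalOdd_gen hd a lam hl hi hi0 x) rfl⟩⟩
  refine (congrArg (fun g => toMatrix (extremalOdd hd a lam hl g)) (gen_eq_E _ _ _ _)).trans ?_
  refine (congrArg toMatrix (extremalOdd_first hd a lam hl x)).trans ?_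
  rw [toMatrix_E_mul_lastRow, single_zero]
  abel

theorem isExtremalEven_extremalEven (h2 : (2 : F) = 0) (hF : ∀ x : F, x = 0 ∨ x = 1) :
    IsExtremalEven hd (extremalEven (d := d) hd h2 hF) := by
  refine ⟨1, Or.inl ⟨fun x => ?_,
    fixesOtherGens_of (fun i hi hi0 x => extremalEven_gen hd h2 hF hi hi0 x) rfl⟩⟩
  refine (congrArg (fun g => toMatrix (extremalEven hd h2 hF g)) (gen_eq_E _ _ _ _)).trans ?_
  refine (congrArg toMatrix (extremalEven_first hd h2 hF x)).trans ?_
  rw [toMatrix_E_mul_lastRow]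
  simp

end lastRow

/-! ### The action on the first subdiagonal -/

variable (F) in
/-- The subgroup generated by the extremal, field, diagonal, inner and central automorphisms and
the flip. -/
def autGen (hd : 5 ≤ d) : Subgroup (MulAut (UT d F)) :=
  Subgroup.closure
    ({φ : MulAut (UT d F) | IsExtremal hd φ} ∪ {φ | IsFieldAut φ} ∪ {φ | IsDiagonalAut φ} ∪
      (innerAuts d F : Set (MulAut (UT d F))) ∪ (centralAuts d F : Set (MulAut (UT d F))) ∪
      {φ | IsFlip φ})

section autGen
variable (hd : 5 ≤ d) {φ : MulAut (UT d F)}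

theorem autGen_of_isExtremal (h : IsExtremal hd φ) : φ ∈ autGen F hd :=
  Subgroup.subset_closure (Or.inl (Or.inl (Or.inl (Or.inl (Or.inl h)))))

theorem autGen_of_isFieldAut (h : IsFieldAut φ) : φ ∈ autGen F hd :=
  Subgroup.subset_closure (Or.inl (Or.inl (Or.inl (Or.inl (Or.inr h)))))

theorem autGen_of_isDiagonalAut (h : IsDiagonalAut φ) : φ ∈ autGen F hd :=
  Subgroup.subset_closure (Or.inl (Or.inl (Or.inl (Or.inr h))))

theorem autGen_of_mem_innerAuts (h : φ ∈ innerAuts d F) : φ ∈ autGen F hd :=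
  Subgroup.subset_closure (Or.inl (Or.inl (Or.inr h)))

theorem autGen_of_mem_centralAuts (h : φ ∈ centralAuts d F) : φ ∈ autGen F hd :=
  Subgroup.subset_closure (Or.inl (Or.inr h))

theorem flip_mem_autGen : flip d F ∈ autGen F hd :=
  Subgroup.subset_closure (Or.inr isFlip_flip)

theorem conj_mem_autGen (s : UT d F) : MulAut.conj s ∈ autGen F hd :=
  autGen_of_mem_innerAuts hd ⟨s, rfl⟩

end autGen

/-- `φ` preserves the vanishing of each entry on the first subdiagonal. -/
def HypStable (φ : MulAut (UT d F)) : Prop := ∀ k g, φ g ∈ Hyp d F k ↔ g ∈ Hyp d F k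

theorem IsUnflipped.hypStable (hd : 5 ≤ d) {φ : MulAut (UT d F)} (h : IsUnflipped φ) :
    HypStable φ := fun k g =>
  ⟨fun H => by simpa using h.inv.mem_Hyp_of hd H, fun H => h.mem_Hyp_of hd H⟩

theorem HypStable.mul {φ ψ : MulAut (UT d F)} (h : HypStable φ) (h' : HypStable ψ) :
    HypStable (φ * ψ) := fun k g => (h k (ψ g)).trans (h' k g)

theorem hypStable_diagAut (t : ℕ → Fˣ) : HypStable (diagAut d t : MulAut (UT d F)) := by
  intro k g
  rw [mem_Hyp, mem_Hyp, coef_diagAut]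
  simp

theorem flip_mem_Hyp {b b' : ℕ} (h : b + b' + 2 = d) (g : UT d F) :
    flip d F g ∈ Hyp d F b ↔ g ∈ Hyp d F b' := by
  rw [mem_Hyp, mem_Hyp, coef_flip_eq_zero_iff (mem_Gam_one g) (by omega) (by omega) (by omega),
    show d - 1 - b = b' + 1 by omega, show d - 1 - (b + 1) = b' by omega]

theorem exists_hypStable (hd : 5 ≤ d) (φ : MulAut (UT d F)) :
    ∃ ψ ∈ autGen F hd, HypStable (ψ * φ) := by
  rcases map_CentHyp hd φ with h | h
  · exact ⟨1, one_mem _, by rw [one_mul]; exact IsUnflipped.hypStable hd h⟩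
  · refine ⟨flip d F, flip_mem_autGen hd, IsUnflipped.hypStable hd fun g => ?_⟩
    have h1 : ∀ g, flip d F g ∈ CentHyp d F 1 ↔ g ∈ CentHyp d F (d - 3) := fun g => by
      rw [mem_CentHyp, mem_CentHyp, flip_mem_Hyp (b := 0) (b' := d - 2) (by omega),
        flip_mem_Hyp (b' := 0) (by omega), flip_mem_Hyp (b := 1) (b' := d - 3) (by omega),
        and_comm (a := g ∈ Hyp d F (d - 2))]
    have h2 : ∀ g, flip d F g ∈ CentHyp d F (d - 3) ↔ g ∈ CentHyp d F 1 := fun g => by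
      rw [mem_CentHyp, mem_CentHyp, flip_mem_Hyp (b := 0) (b' := d - 2) (by omega),
        flip_mem_Hyp (b' := 0) (by omega), flip_mem_Hyp (b' := 1) (by omega),
        and_comm (a := g ∈ Hyp d F (d - 2))]
    exact ⟨(h1 _).trans (h g).2, (h2 _).trans (h g).1⟩

/-- The action of an automorphism on the entry `(i + 1, i)`. -/
noncomputable def subdiag (φ : MulAut (UT d F)) (i : ℕ) (x : F) : F :=
  coef (φ (E (i + 1) i x)) (i + 1) i

namespace HypStable
variable {φ : MulAut (UT d F)}

theorem coef_gen_of_ne (H : HypStable φ) {i b : ℕ} (hi : i + 1 < d) (hb : b ≠ i) (x : F) :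
    coef (φ (E (i + 1) i x)) (b + 1) b = 0 :=
  (H b _).2 (E_mem_Hyp hi (by omega) (by omega) x)

theorem subdiag_ne_zero (H : HypStable φ) {i : ℕ} (hi : i + 1 < d) {x : F} (hx : x ≠ 0) :
    subdiag φ i x ≠ 0 := by
  intro h
  have := mem_Hyp.1 ((H i _).1 h)
  rw [coef_E_self hi (by omega)] at this
  exact hx this

theorem subdiag_surjective (H : HypStable φ) {i : ℕ} (hi : i + 1 < d) :
    Function.Surjective (subdiag φ i) := by
  intro y
  obtain ⟨g, hg⟩ := φ.surjective (E (i + 1) i y)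
  refine ⟨coef g (i + 1) i, ?_⟩
  have h1 : g * (E (i + 1) i (coef g (i + 1) i))⁻¹ ∈ Hyp d F i := by
    rw [mem_Hyp, coef_mul_lead (mem_Gam_one _) (mem_Gam_one _) (by omega),
      coef_inv_lead (mem_Gam_one _) (by omega), coef_E_self hi (by omega), add_neg_cancel]
  have h2 := mem_Hyp.1 ((H i _).2 h1)
  rw [map_mul, map_inv, hg, coef_mul_lead (mem_Gam_one _) (mem_Gam_one _) (by omega),
      coef_inv_lead (mem_Gam_one _) (by omega), coef_E_self hi (by omega)] at h2
  exact (add_neg_eq_zero.1 h2).symm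

/-- The left side depends only on the product `y * x`. Hence, once all values at 1 are 1,
neighbouring maps `subdiag φ i` coincide and the common map is multiplicative. -/
theorem subdiag_mul (H : HypStable φ) {i : ℕ} (hi : i + 2 < d) (x y : F) :
    coef (φ (E (i + 2) i (y * x))) (i + 2) i = subdiag φ (i + 1) y * subdiag φ i x := by
  rw [← E_commutator hi (show i + 1 < i + 2 by omega) (by omega), map_commutatorElement,
    coef_commutator (mem_Gam_one _) (mem_Gam_one _) (u := i + 1) (v := i + 1) (by omega) rfl rfl,
    H.coef_gen_of_ne (i := i) (b := i + 1) (by omega) (by omega), zero_mul, sub_zero]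
  rfl

end HypStable

theorem subdiag_add (φ : MulAut (UT d F)) {i : ℕ} (hi : i + 1 < d) (x y : F) :
    subdiag φ i (x + y) = subdiag φ i x + subdiag φ i y := by
  rw [subdiag, E_add hi (by omega), map_mul,
    coef_mul_lead (mem_Gam_one _) (mem_Gam_one _) (by omega)]
  rfl

theorem exists_subdiag_one (hd : 5 ≤ d) {φ : MulAut (UT d F)} (H : HypStable φ) :
    ∃ ψ ∈ autGen F hd, HypStable (ψ * φ) ∧ ∀ i, i + 1 < d → subdiag (ψ * φ) i 1 = 1 := by
  have h : ∀ i, ∃ u : Fˣ, i + 1 < d → subdiag φ i 1 = u := fun i => by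
    by_cases hi : i + 1 < d
    · exact ⟨Units.mk0 _ (H.subdiag_ne_zero hi one_ne_zero), fun _ => rfl⟩
    · exact ⟨1, fun h => absurd h hi⟩
  choose u hu using h
  -- Since `t (i + 1) = t i * u i`, conjugation divides the entry `(i + 1, i)` by `u i`.
  let t : ℕ → Fˣ := fun i => ∏ j ∈ Finset.range i, u j
  refine ⟨diagAut d t, autGen_of_isDiagonalAut hd (isDiagonalAut_diagAut t),
    (hypStable_diagAut t).mul H, fun i hi => ?_⟩
  have ht : t (i + 1) = t i * u i := Finset.prod_range_succ _ _
  change coef (diagAut d t (φ _)) _ _ = 1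
  rw [coef_diagAut]
  change _ * subdiag φ i 1 * _ = 1
  rw [hu i hi, ht]
  simp [mul_comm]

theorem exists_field_equiv (hd : 5 ≤ d) {φ : MulAut (UT d F)} (H : HypStable φ)
    (h1 : ∀ i, i + 1 < d → subdiag φ i 1 = 1) :
    ∃ μ : F ≃+* F, ∀ i, i + 1 < d → ∀ x, subdiag φ i x = μ x := by
  have hs : ∀ i, i + 2 < d → ∀ x, subdiag φ (i + 1) x = subdiag φ i x := by
    intro i hi x
    have e1 := H.subdiag_mul hi x 1
    have e2 := H.subdiag_mul hi 1 x
    rw [h1 _ (by omega), one_mul, one_mul] at e1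
    rw [h1 _ (by omega), mul_one, mul_one] at e2
    rw [← e1, ← e2]
  have h0 : ∀ i, i + 1 < d → ∀ x, subdiag φ i x = subdiag φ 0 x := by
    intro i
    induction i with
    | zero => intro _ _; rfl
    | succ i ih => intro hi x; rw [hs i hi, ih (by omega)]
  have hmul : ∀ x y, subdiag φ 0 (x * y) = subdiag φ 0 x * subdiag φ 0 y := by
    intro x y
    have e1 := H.subdiag_mul (i := 0) (by omega) y x
    have e2 := H.subdiag_mul (i := 0) (by omega) (x * y) 1
    rw [h1 _ (by omega), one_mul, one_mul] at e2
    rw [← e2, e1, h0 (0 + 1) (by omega)]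
  have hadd := subdiag_add φ (i := 0) (by omega)
  let f : F →+* F :=
    { toFun := subdiag φ 0
      map_one' := h1 0 (by omega)
      map_mul' := hmul
      map_zero' := by simpa using hadd 0 0
      map_add' := hadd }
  refine ⟨RingEquiv.ofBijective f ⟨f.injective, H.subdiag_surjective (i := 0) (by omega)⟩,
    fun i hi x => ?_⟩
  rw [h0 i hi]
  rfl

/-- The deviation of an automorphism from the identity. -/
def dev (φ : MulAut (UT d F)) (g : UT d F) : UT d F := g⁻¹ * φ g

theorem mul_dev (φ : MulAut (UT d F)) (g : UT d F) : g * dev φ g = φ g := by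
  simp [dev]

/-- The automorphism `φ` fixes the generators modulo `Gam d F m`. -/
def Level (m : ℕ) (φ : MulAut (UT d F)) : Prop :=
  ∀ i x, i + 1 < d → dev φ (E (i + 1) i x) ∈ Gam d F m

theorem exists_level_two (hd : 5 ≤ d) (φ : MulAut (UT d F)) :
    ∃ ψ ∈ autGen F hd, Level 2 (ψ * φ) := by
  obtain ⟨ψ₁, hψ₁, H₁⟩ := exists_hypStable hd φ
  obtain ⟨ψ₂, hψ₂, H₂, h1⟩ := exists_subdiag_one hd H₁
  obtain ⟨μ, hμ⟩ := exists_field_equiv hd H₂ h1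
  refine ⟨fieldAut d μ.symm * (ψ₂ * ψ₁), mul_mem (autGen_of_isFieldAut hd
    (isFieldAut_fieldAut μ.symm)) (mul_mem hψ₂ hψ₁), fun i x hi => ?_⟩
  refine mem_Gam_succ (mem_Gam_one _) fun b => ?_
  rw [dev, coef_mul_lead (mem_Gam_one _) (mem_Gam_one _) (by omega),
    coef_inv_lead (mem_Gam_one _) (by omega)]
  change _ + coef (fieldAut d μ.symm ((ψ₂ * (ψ₁ * φ)) _)) _ _ = 0
  rw [coef_fieldAut]
  by_cases hb : b = i
  · subst hb
    rw [coef_E_self hi (by omega)]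
    change _ + μ.symm (subdiag _ b x) = 0
    rw [hμ b hi]
    simp
  · rw [H₂.coef_gen_of_ne hi hb, coef_E_of_ne hi (by omega) _ (by omega)]
    simp

/-! ### Automorphisms which are trivial on the first subdiagonal -/

/-- The difference between the matrices of `φ g` and `g`. -/
def diff (φ : MulAut (UT d F)) (g : UT d F) : Matrix (Fin d) (Fin d) F :=
  toMatrix (φ g) - toMatrix g

theorem diff_eq_mul (φ : MulAut (UT d F)) (g : UT d F) :
    diff φ g = toMatrix g * nil (dev φ g) := by
  rw [diff, nil, dev, toMatrix_mul, mul_sub, ← mul_assoc, toMatrix_mul_inv, one_mul, mul_one]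

theorem nil_dev (φ : MulAut (UT d F)) (g : UT d F) :
    nil (dev φ g) = toMatrix g⁻¹ * diff φ g := by
  rw [diff_eq_mul, ← mul_assoc, toMatrix_inv_mul, one_mul]

theorem dev_mem_iff {φ : MulAut (UT d F)} {g : UT d F} {k : ℕ} :
    dev φ g ∈ Gam d F k ↔ diff φ g ∈ band d F k := by
  constructor
  · intro h
    rw [diff_eq_mul]
    exact toMatrix_mul_mem h g
  · intro h
    rw [mem_Gam, nil_dev]
    exact toMatrix_mul_mem h _

theorem ent_diff_lead {φ : MulAut (UT d F)} {g : UT d F} {k : ℕ} (h : dev φ g ∈ Gam d F k)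
    (j : ℕ) : ent (diff φ g) (j + k) j = coef (dev φ g) (j + k) j := by
  rw [diff_eq_mul, ent_toMatrix_mul_lead h]
  rfl

theorem nil_map (φ : MulAut (UT d F)) (g : UT d F) : nil (φ g) = nil g + diff φ g := by
  simp only [nil, diff]; abel

/-- This subtracts `nil_commutator_mul` for `g`, `h` from the same identity for their images. The
first two brackets are the Leibniz rule, the third is quadratic in `diff φ`, and the last term
corrects for the changed right factor; the last two lie deeper. -/
theorem diff_commutator_mul (φ : MulAut (UT d F)) (g h : UT d F) :
    diff φ ⁅g, h⁆ * toMatrix (φ h * φ g) =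
      (nil g * diff φ h - diff φ h * nil g) + (diff φ g * nil h - nil h * diff φ g) +
        (diff φ g * diff φ h - diff φ h * diff φ g) -
        nil ⁅g, h⁆ * (toMatrix (φ h * φ g) - toMatrix (h * g)) := by
  have r1 := nil_commutator_mul g h
  have r2 := nil_commutator_mul (φ g) (φ h)
  rw [← map_commutatorElement] at r2
  simp only [nil_map φ] at r2
  rw [add_mul, ← sub_eq_zero] at r2
  rw [← sub_eq_zero] at r1 ⊢
  rw [← sub_eq_zero.2 (r2.trans r1.symm)]
  noncomm_ring

section commutator
variable {φ : MulAut (UT d F)} {g h : UT d F} {k l n : ℕ}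

theorem diff_commutator_mul_sub_mem (hk : 1 ≤ k) (hl : 1 ≤ l) (hn : 1 ≤ n)
    (hg : g ∈ Gam d F k) (hh : h ∈ Gam d F l)
    (hg' : diff φ g ∈ band d F (k + n)) (hh' : diff φ h ∈ band d F (l + n)) :
    diff φ ⁅g, h⁆ * toMatrix (φ h * φ g) -
      ((nil g * diff φ h - diff φ h * nil g) + (diff φ g * nil h - nil h * diff φ g)) ∈
        band d F (k + l + n + 1) := by
  have e : toMatrix (φ h * φ g) - toMatrix (h * g) ∈ band d F (n + 1) := by
    have : toMatrix (φ h * φ g) - toMatrix (h * g) =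
        diff φ h * toMatrix (φ g) + toMatrix h * diff φ g := by
      simp only [diff, toMatrix_mul]; noncomm_ring
    rw [this]
    exact add_mem (band_anti (by omega) (mul_toMatrix_mem hh' _))
      (band_anti (by omega) (toMatrix_mul_mem hg' _))
  rw [diff_commutator_mul, add_sub_assoc, add_sub_cancel_left]
  refine sub_mem (sub_mem (mul_mem_band' hg' hh' (by omega)) (mul_mem_band' hh' hg' (by omega))) ?_
  exact mul_mem_band' (commutator_mem_Gam hg hh le_rfl) e (by omega)

theorem diff_bracket_mem (hg : g ∈ Gam d F k) (hh : h ∈ Gam d F l)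
    (hg' : diff φ g ∈ band d F (k + n)) (hh' : diff φ h ∈ band d F (l + n)) :
    (nil g * diff φ h - diff φ h * nil g) + (diff φ g * nil h - nil h * diff φ g) ∈
      band d F (k + l + n) :=
  add_mem (sub_mem (mul_mem_band' hg hh' (by omega)) (mul_mem_band' hh' hg (by omega)))
    (sub_mem (mul_mem_band' hg' hh (by omega)) (mul_mem_band' hh hg' (by omega)))

theorem diff_commutator_mem (hk : 1 ≤ k) (hl : 1 ≤ l) (hn : 1 ≤ n) (hg : g ∈ Gam d F k)
    (hh : h ∈ Gam d F l) (hg' : diff φ g ∈ band d F (k + n)) (hh' : diff φ h ∈ band d F (l + n)) :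
    diff φ ⁅g, h⁆ ∈ band d F (k + l + n) := by
  have h1 := add_mem (band_anti (by omega) (diff_commutator_mul_sub_mem hk hl hn hg hh hg' hh'))
    (diff_bracket_mem hg hh hg' hh')
  rw [sub_add_cancel] at h1
  have h2 := mul_toMatrix_mem h1 (φ h * φ g)⁻¹
  rwa [mul_assoc, toMatrix_mul_inv, mul_one] at h2

theorem ent_diff_commutator (hk : 1 ≤ k) (hl : 1 ≤ l) (hn : 1 ≤ n) (hg : g ∈ Gam d F k)
    (hh : h ∈ Gam d F l) (hg' : diff φ g ∈ band d F (k + n)) (hh' : diff φ h ∈ band d F (l + n))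
    {i j : ℕ} (hij : i = j + (k + l + n)) :
    ent (diff φ ⁅g, h⁆) i j =
      ent (nil g * diff φ h - diff φ h * nil g) i j +
        ent (diff φ g * nil h - nil h * diff φ g) i j := by
  subst hij
  have h1 := diff_commutator_mul_sub_mem hk hl hn hg hh hg' hh' (j + (k + l + n)) j (by omega)
  rw [ent_sub, ent_mul_toMatrix_lead (diff_commutator_mem hk hl hn hg hh hg' hh'), ent_add,
    sub_eq_zero] at h1
  exact h1

/-- When `g` and `h` commute, only the quadratic error remains, so the Leibniz relation holds beyond
the leading subdiagonal. -/
theorem ent_diff_bracket_of_comm (hg : diff φ g ∈ band d F k) (hh : diff φ h ∈ band d F l)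
    (hc : g * h = h * g) {i j : ℕ} (hij : i < j + (k + l)) :
    ent (nil g * diff φ h - diff φ h * nil g) i j +
        ent (diff φ g * nil h - nil h * diff φ g) i j = 0 := by
  have e0 : ⁅g, h⁆ = 1 := commutatorElement_eq_one_iff_mul_comm.2 hc
  have e := diff_commutator_mul φ g h
  have e1 : diff φ (1 : UT d F) = 0 := by simp [diff]
  rw [e0, e1, nil_one, zero_mul, zero_mul, sub_zero] at e
  have e2 := congrArg (fun M => ent M i j) e
  simp only [ent_add, ent_zero] at e2
  rw [ent_sub (diff φ g * diff φ h), mul_mem_band hg hh _ _ hij,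
    mul_mem_band' hh hg (n := k + l) (by omega) _ _ hij, sub_zero, add_zero] at e2
  exact e2.symm

end commutator

theorem ent_sgl_bracket {p q : ℕ} (hp : p < d) (hq : q < p) (x : F)
    (M : Matrix (Fin d) (Fin d) F) (a b : ℕ) :
    ent (nil (E p q x) * M - M * nil (E p q x)) a b =
      (if a = p then x * ent M q b else 0) - if b = q then ent M a p * x else 0 := by
  rw [nil_E hp hq, ent_sub, ent_mul_sgl hp (by omega), ent_sgl_mul hp (by omega)]

theorem ent_bracket_sgl {p q : ℕ} (hp : p < d) (hq : q < p) (x : F)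
    (M : Matrix (Fin d) (Fin d) F) (a b : ℕ) :
    ent (M * nil (E p q x) - nil (E p q x) * M) a b =
      (if b = q then ent M a p * x else 0) - if a = p then x * ent M q b else 0 := by
  rw [nil_E hp hq, ent_sub, ent_mul_sgl hp (by omega), ent_sgl_mul hp (by omega)]

section level
variable {φ : MulAut (UT d F)} {n : ℕ}

theorem level_iff {m : ℕ} :
    Level m φ ↔ ∀ i x, i + 1 < d → diff φ (E (i + 1) i x) ∈ band d F m :=
  forall₃_congr fun _ _ _ => dev_mem_iff

/-- Elementary matrices are iterated commutators of generators, and the Leibniz rule preserves the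
shift by `n`. -/
theorem Level.diff_E_mem (H : Level (n + 1) φ) (hn : 1 ≤ n) {k q : ℕ} (hk : 1 ≤ k) (h : q + k < d)
    (x : F) : diff φ (E (q + k) q x) ∈ band d F (k + n) := by
  induction k, hk using Nat.le_induction with
  | base => rw [add_comm 1 n]; exact level_iff.1 H q x h
  | succ k hk ih =>
    have e : (E (q + (k + 1)) q x : UT d F) =
        ⁅(E (q + k + 1) (q + k) 1 : UT d F), (E (q + k) q x : UT d F)⁆ := by
      rw [E_commutator (by omega) (by omega) (by omega), one_mul]; rfl
    rw [e, add_comm k 1]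
    refine diff_commutator_mem le_rfl hk hn (mem_Gam_one _)
      (E_mem_Gam (by omega) (by omega) le_rfl _) ?_ (ih (by omega))
    rw [add_comm 1 n]
    exact level_iff.1 H _ _ (by omega)

/-- `dev φ` is a crossed homomorphism with respect to conjugation, so elementary matrices suffice.
-/
theorem Level.dev_mem (H : Level (n + 1) φ) (hn : 1 ≤ n) {k : ℕ} (hk : 1 ≤ k) :
    ∀ g ∈ Gam d F k, dev φ g ∈ Gam d F (k + n) := by
  refine Gam_induction hk ?_ (fun g _ h _ hg hh => ?_) fun i j x hi hij => ?_
  · simp [dev]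
  · have : dev φ (g * h) = h⁻¹ * dev φ g * h * dev φ h := by
      simp only [dev, map_mul]; group
    rw [this]
    exact mul_mem (conj_mem_Gam hg h) hh
  · obtain ⟨l, rfl⟩ : ∃ l, i = j + l := ⟨i - j, by omega⟩
    exact Gam_anti (by omega) (dev_mem_iff.2 (H.diff_E_mem hn (k := l) (by omega) hi x))

theorem Level.comm_E (H : Level (n + 1) φ) (hn : 1 ≤ n) {i p q : ℕ} (hi : i + 1 < d) (hp : p < d)
    (hq : q < p) (h1 : p ≠ i) (h2 : q ≠ i + 1) (x y : F) {a b : ℕ}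
    (hab : a + q < b + p + (n + n + 1)) :
    ((if a = i + 1 then x * ent (diff φ (E p q y)) i b else 0) -
      if b = i then ent (diff φ (E p q y)) a (i + 1) * x else 0) +
    ((if b = q then ent (diff φ (E (i + 1) i x)) a p * y else 0) -
      if a = p then y * ent (diff φ (E (i + 1) i x)) q b else 0) = 0 := by
  obtain ⟨k, rfl⟩ : ∃ k, p = q + k := ⟨p - q, by omega⟩
  rw [← ent_sgl_bracket hi (by omega), ← ent_bracket_sgl hp hq]
  exact ent_diff_bracket_of_comm (level_iff.1 H i x hi) (H.diff_E_mem hn (by omega) hp y)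
    (E_comm hi (by omega) hp hq (by omega) h2 x y) (by omega)

/-- `E b q` commutes with the generator, and their relation at position `(a, q)` isolates the entry
`(a, b)`. -/
theorem Level.ent_eq_zero_of_col (H : Level (n + 1) φ) (hn : 1 ≤ n) {i a b : ℕ} (hi : i + 1 < d)
    (ha : a < d) (hab : a = b + (n + 1)) (hai : a ≠ i + 1) (hbi : b ≠ i) {q : ℕ} (hq : q < b)
    (hqi : q ≠ i) (hqi' : q ≠ i + 1) (x : F) : ent (diff φ (E (i + 1) i x)) a b = 0 := by
  have := H.comm_E hn hi (p := b) (by omega) hq hbi hqi' x 1 (a := a) (b := q) (by omega)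
  rw [if_neg hai, if_neg hqi, if_pos rfl, if_neg (by omega)] at this
  simpa using this

theorem Level.ent_eq_zero_of_row (H : Level (n + 1) φ) (hn : 1 ≤ n) {i a b : ℕ} (hi : i + 1 < d)
    (hab : a = b + (n + 1)) (hai : a ≠ i + 1) (hbi : b ≠ i) {p : ℕ} (hp : p < d) (hap : a < p)
    (hpi : p ≠ i) (hpi' : p ≠ i + 1) (x : F) : ent (diff φ (E (i + 1) i x)) a b = 0 := by
  have := H.comm_E hn hi hp hap hpi hai x 1 (a := p) (b := b) (by omega)
  rw [if_neg hpi', if_neg hbi, if_neg (by omega), if_pos rfl] at this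
  simpa using this

variable (d) in
/-- The positions of the entries created by extremal automorphisms. -/
def Special (i a b : ℕ) : Prop :=
  (i = 0 ∧ a = d - 1 ∧ (b = 1 ∨ b = 2)) ∨ (i + 2 = d ∧ b = 0 ∧ (a = d - 2 ∨ a = d - 3))

theorem Level.ent_eq_zero (hd : 5 ≤ d) (H : Level (n + 1) φ) (hn : 1 ≤ n) (hnd : n + 3 ≤ d)
    {i a b : ℕ} (hi : i + 1 < d) (ha : a < d) (hab : a = b + (n + 1)) (hai : a ≠ i + 1)
    (hbi : b ≠ i) (hs : ¬Special d i a b) (x : F) : ent (diff φ (E (i + 1) i x)) a b = 0 := by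
  unfold Special at hs
  -- The auxiliary elementary matrix uses column `0` or row `d - 1` where possible. Otherwise either
  -- `i = 0` and the entry is in the last row with `b ≥ 3`, or `i = d - 2` and it is in the first
  -- column with `a < d - 3`. Column `2` and row `d - 3` then still work.
  by_cases h1 : 1 ≤ i ∧ 1 ≤ b
  · exact H.ent_eq_zero_of_col hn hi ha hab hai hbi (q := 0) (by omega) (by omega) (by omega) x
  by_cases h2 : i + 2 < d ∧ a + 1 < d
  · exact H.ent_eq_zero_of_row hn hi hab hai hbi (p := d - 1) (by omega) (by omega) (by omega)
      (by omega) x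
  by_cases h3 : i = 0
  · exact H.ent_eq_zero_of_col hn hi ha hab hai hbi (q := 2) (by omega) (by omega) (by omega) x
  · exact H.ent_eq_zero_of_row hn hi hab hai hbi (p := d - 3) (by omega) (by omega) (by omega)
      (by omega) x

theorem Level.ent_gen_commutator (H : Level (n + 1) φ) (hn : 1 ≤ n) {i : ℕ} (hi : i + 2 < d)
    (x y : F) {a b : ℕ} (hab : a = b + (n + 2)) :
    ent (diff φ (E (i + 2) i (y * x))) a b =
      ((if a = i + 2 then y * ent (diff φ (E (i + 1) i x)) (i + 1) b else 0) -
        if b = i + 1 then ent (diff φ (E (i + 1) i x)) a (i + 2) * y else 0) +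
      ((if b = i then ent (diff φ (E (i + 2) (i + 1) y)) a (i + 1) * x else 0) -
        if a = i + 1 then x * ent (diff φ (E (i + 2) (i + 1) y)) i b else 0) := by
  have h1 := level_iff.1 H i x (by omega)
  have h2 := level_iff.1 H (i + 1) y (by omega)
  rw [add_comm n 1] at h1 h2
  rw [← E_commutator hi (show i + 1 < i + 2 by omega) (by omega),
    ent_diff_commutator le_rfl le_rfl hn (mem_Gam_one _) (mem_Gam_one _) h2 h1 (by omega),
    ent_sgl_bracket hi (by omega), ent_bracket_sgl (by omega) (by omega)]

/-- The image of `E (i + 2) i (y * x)` depends only on the product, so the factorizations `1 * x`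
and `x * 1` can be compared. -/
theorem Level.linear_row (H : Level (n + 1) φ) (hn : 1 ≤ n) {i b : ℕ} (hi : i + 2 < d)
    (hb : i = b + n) (x : F) : ent (diff φ (E (i + 1) i x)) (i + 1) b =
      x * ent (diff φ (E (i + 1) i 1)) (i + 1) b := by
  have key : ∀ x y : F, ent (diff φ (E (i + 2) i (y * x))) (i + 2) b =
      y * ent (diff φ (E (i + 1) i x)) (i + 1) b := fun x y => by
    rw [H.ent_gen_commutator hn hi x y (by omega), if_pos rfl, if_neg (by omega),
      if_neg (by omega), if_neg (by omega)]
    ring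
  have h1 := key x 1
  have h2 := key 1 x
  rw [one_mul, one_mul] at h1
  rw [mul_one] at h2
  rw [← h1, h2]

theorem Level.linear_col (H : Level (n + 1) φ) (hn : 1 ≤ n) {i a : ℕ} (hi : i + 2 < d)
    (ha : a = i + n + 2) (x : F) : ent (diff φ (E (i + 2) (i + 1) x)) a (i + 1) =
      x * ent (diff φ (E (i + 2) (i + 1) 1)) a (i + 1) := by
  have key : ∀ x y : F, ent (diff φ (E (i + 2) i (y * x))) a i =
      ent (diff φ (E (i + 2) (i + 1) y)) a (i + 1) * x := fun x y => by
    rw [H.ent_gen_commutator hn hi x y (by omega), if_neg (by omega), if_neg (by omega),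
      if_pos rfl, if_neg (by omega)]
    ring
  have h1 := key x 1
  have h2 := key 1 x
  rw [one_mul] at h1
  rw [mul_one, mul_one] at h2
  rw [← h2, h1, mul_comm]

/-- Two distant commuting generators, compared at position `(i + n + 2, i)`. -/
theorem Level.row_add_col (H : Level (n + 1) φ) (hn : 1 ≤ n) {i : ℕ} (hi : i + n + 2 < d)
    (x y : F) :
    ent (diff φ (E (i + n + 2) (i + n + 1) y)) (i + n + 2) (i + 1) * x =
      -(y * ent (diff φ (E (i + 1) i x)) (i + n + 1) i) := by
  have := H.comm_E hn (i := i) (by omega) hi (q := i + n + 1) (by omega) (by omega) (by omega) x y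
    (a := i + n + 2) (b := i) (by omega)
  rw [if_neg (by omega), if_pos rfl, if_neg (by omega), if_pos rfl] at this
  linear_combination -this

/-- The leading entries of the generators which are of the type created by inner automorphisms
come from a single sequence. -/
theorem Level.exists_inner (H : Level (n + 1) φ) (hn : 1 ≤ n) (hnd : n + 3 ≤ d) :
    ∃ u : ℕ → F,
      (∀ i b, i + 1 < d → i = b + n → ∀ x,
        ent (diff φ (E (i + 1) i x)) (i + 1) b = x * u b) ∧
      ∀ i, i + n + 1 < d → ∀ x,
        ent (diff φ (E (i + 1) i x)) (i + n + 1) i = -(x * u (i + 1)) := by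
  -- `u b` is read from the row entry of generator `b + n`. For `b = d - n - 1` that generator does
  -- not exist, and the column entry of generator `b - 1` is used; `hnd` ensures `b ≥ 1` there.
  refine ⟨fun b => if b + n + 1 < d then ent (diff φ (E (b + n + 1) (b + n) 1)) (b + n + 1) b
    else -ent (diff φ (E b (b - 1) 1)) (b - 1 + n + 1) (b - 1), ?_, ?_⟩
  · rintro i b hi rfl x
    dsimp only
    rw [if_pos hi]
    by_cases h : b + n + 2 < d
    · exact H.linear_row hn (by omega) rfl x
    · obtain ⟨c, rfl⟩ : ∃ c, b = c + 1 := ⟨b - 1, by omega⟩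
      have e1 := H.row_add_col hn (i := c) (by omega) 1 x
      have e2 := H.row_add_col hn (i := c) (by omega) 1 1
      rw [show c + 1 + n = c + n + 1 by ring]
      linear_combination e1 - x * e2
  · intro i hi x
    dsimp only
    split_ifs with h
    · have e := H.row_add_col hn (i := i) (by omega) x 1
      rw [show i + 1 + n = i + n + 1 by ring]
      linear_combination e
    · obtain ⟨c, rfl⟩ : ∃ c, i = c + 1 := ⟨i - 1, by omega⟩
      rw [Nat.add_sub_cancel]
      have := H.linear_col hn (i := c) (by omega) (a := c + 1 + n + 1) (by omega) x
      linear_combination this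

end level

/-- Conjugation by `s` adds the bracket of `s` with `g` on the leading subdiagonal; its bracket with
`diff φ g` lies deeper. -/
theorem ent_diff_conj_mul {φ : MulAut (UT d F)} {n : ℕ} (hn : 1 ≤ n) {s g : UT d F}
    (hs : s ∈ Gam d F n) (hg : diff φ g ∈ band d F (n + 1)) :
    diff (MulAut.conj s * φ) g ∈ band d F (n + 1) ∧
    ∀ b, ent (diff (MulAut.conj s * φ) g) (b + (n + 1)) b =
      ent (diff φ g) (b + (n + 1)) b + ent (nil s * nil g - nil g * nil s) (b + (n + 1)) b := by
  have e : diff (MulAut.conj s * φ) g = diff φ g +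
      ((nil s * nil g - nil g * nil s) + (nil s * diff φ g - diff φ g * nil s)) *
        toMatrix s⁻¹ := by
    have e1 : (nil s * nil g - nil g * nil s) + (nil s * diff φ g - diff φ g * nil s) =
        toMatrix s * toMatrix (φ g) - toMatrix (φ g) * toMatrix s := by
      simp only [nil, diff]; noncomm_ring
    rw [e1, sub_mul, mul_assoc _ (toMatrix s), toMatrix_mul_inv, mul_one]
    simp only [diff, MulAut.mul_apply, MulAut.conj_apply, toMatrix_mul]
    abel
  have h1 : nil s * nil g - nil g * nil s ∈ band d F (n + 1) :=
    sub_mem (mul_mem_band' hs (nil_mem g) le_rfl) (mul_mem_band' (nil_mem g) hs (by omega))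
  have h2 : nil s * diff φ g - diff φ g * nil s ∈ band d F (n + 1 + 1) :=
    sub_mem (mul_mem_band' hs hg (by omega)) (mul_mem_band' hg hs (by omega))
  have h3 := add_mem h1 (band_anti (by omega) h2)
  rw [e]
  refine ⟨add_mem hg (mul_toMatrix_mem h3 _), fun b => ?_⟩
  rw [ent_add, ent_mul_toMatrix_lead h3, ent_add (nil s * nil g - nil g * nil s),
    h2 _ _ (by omega), add_zero]

theorem of_subdiagonal_mem_band {n : ℕ} (hn : 1 ≤ n) (u : ℕ → F) :
    Matrix.of (fun a b : Fin d => if (a : ℕ) = b + n then u b else 0) ∈ band d F 1 := by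
  intro i j hij
  unfold ent
  split_ifs
  · rw [of_apply, if_neg (by simp only; omega)]
  · rfl

/-- The unitriangular matrix with given entries on the `n`-th subdiagonal, and `0` on the others. -/
noncomputable def diagElt (d n : ℕ) (hn : 1 ≤ n) (u : ℕ → F) : UT d F :=
  ofNil _ (of_subdiagonal_mem_band hn u)

theorem coef_diagElt {n : ℕ} (hn : 1 ≤ n) (u : ℕ → F) {a b : ℕ} (ha : a < d) :
    coef (diagElt d n hn u) a b = if a = b + n then u b else 0 := by
  rw [coef, diagElt, nil_ofNil]
  unfold ent
  by_cases hb : b < d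
  · rw [dif_pos ⟨ha, hb⟩]; rfl
  · rw [dif_neg (by omega), if_neg (by omega)]

theorem diagElt_mem {n : ℕ} (hn : 1 ≤ n) (u : ℕ → F) : diagElt d n hn u ∈ Gam d F n := by
  intro i j hij
  change coef _ _ _ = 0
  by_cases hi : i < d
  · rw [coef_diagElt hn u hi, if_neg (by omega)]
  · exact coef_eq_zero_of_le _ (by omega)

/-- The leading entries of the generators vanish outside of the special positions. -/
def Reduced (m : ℕ) (φ : MulAut (UT d F)) : Prop :=
  Level m φ ∧ ∀ i x b, i + 1 < d → ¬Special d i (b + m) b →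
    ent (diff φ (E (i + 1) i x)) (b + m) b = 0

theorem Level.exists_reduced (hd : 5 ≤ d) {φ : MulAut (UT d F)} {n : ℕ} (H : Level (n + 1) φ)
    (hn : 1 ≤ n) (hnd : n + 3 ≤ d) : ∃ s, Reduced (n + 1) (MulAut.conj s * φ) := by
  obtain ⟨u, hu1, hu2⟩ := H.exists_inner hn hnd
  have hs := diagElt_mem (d := d) hn u
  refine ⟨diagElt d n hn u, level_iff.2 fun i x hi =>
    (ent_diff_conj_mul hn hs (level_iff.1 H i x hi)).1, fun i x b hi hsp => ?_⟩
  by_cases hbd : b + (n + 1) < d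
  swap
  · exact ent_eq_zero_of_le _ (by omega)
  rw [(ent_diff_conj_mul hn hs (level_iff.1 H i x hi)).2, ent_bracket_sgl hi (by omega)]
  change _ + ((if b = i then coef (diagElt d n hn u) _ _ * x else 0) -
    if b + (n + 1) = i + 1 then x * coef (diagElt d n hn u) _ _ else 0) = 0
  by_cases h1 : b = i
  · subst h1
    rw [if_pos rfl, if_neg (by omega), coef_diagElt hn u hbd, if_pos (by omega),
      show b + (n + 1) = b + n + 1 by ring, hu2 b (by omega)]
    ring
  · rw [if_neg h1]
    by_cases h2 : b + (n + 1) = i + 1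
    · rw [if_pos h2, coef_diagElt hn u (by omega), if_pos (by omega), h2, hu1 i b hi (by omega)]
      ring
    · rw [if_neg h2, H.ent_eq_zero hd hn hnd hi hbd rfl h2 h1 hsp]
      ring

/-! ### The last two steps -/

section reduced
variable {φ : MulAut (UT d F)} {n m : ℕ}

theorem Reduced.coef_dev (H : Reduced m φ) {i b : ℕ} (hi : i + 1 < d)
    (hs : ¬Special d i (b + m) b) (x : F) : coef (dev φ (E (i + 1) i x)) (b + m) b = 0 := by
  rw [← ent_diff_lead (H.1 i x hi)]
  exact H.2 i x b hi hs

theorem reduced_of_coef_dev (H : Level m φ) (h : ∀ i x b, i + 1 < d → ¬Special d i (b + m) b →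
    coef (dev φ (E (i + 1) i x)) (b + m) b = 0) : Reduced m φ :=
  ⟨H, fun i x b hi hs => by rw [ent_diff_lead (H i x hi)]; exact h i x b hi hs⟩

theorem Reduced.dev_mem_succ (H : Reduced m φ) {i : ℕ} (hi : i + 1 < d)
    (hs : ∀ b, ¬Special d i (b + m) b) (x : F) :
    dev φ (E (i + 1) i x) ∈ Gam d F (m + 1) :=
  mem_Gam_succ (H.1 i x hi) fun b => H.coef_dev hi (hs b) x

theorem dev_flip_conj (φ : MulAut (UT d F)) (g : UT d F) :
    dev (flip d F * φ * flip d F) g = flip d F (dev φ (flip d F g)) := by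
  simp only [dev, map_mul, map_inv, flip_flip, MulAut.mul_apply]

theorem flip_gen {i : ℕ} (hi : i + 1 < d) (x : F) :
    flip d F (E (i + 1) i x) = E (d - 2 - i + 1) (d - 2 - i) x := by
  rw [flip_E hi, show d - 1 - i = d - 2 - i + 1 by omega, show d - 1 - (i + 1) = d - 2 - i by omega]

theorem Level.flip_conj (H : Level m φ) : Level m (flip d F * φ * flip d F) := by
  intro i x hi
  rw [dev_flip_conj, map_mem_Gam, flip_gen hi]
  exact H _ x (by omega)

theorem Reduced.flip_conj (hm : 1 ≤ m) (H : Reduced m φ) :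
    Reduced m (flip d F * φ * flip d F) := by
  refine reduced_of_coef_dev H.1.flip_conj fun i x b hi hs => ?_
  by_cases hb : b + m < d
  · rw [dev_flip_conj, flip_gen hi, coef_flip_eq_zero_iff (H.1 _ x (by omega)) hb (by omega)
      (by omega), show d - 1 - b = d - 1 - (b + m) + m by omega]
    refine H.coef_dev (by omega) (fun h => hs ?_) x
    unfold Special at h ⊢
    omega
  · exact coef_eq_zero_of_le _ (by omega)

theorem Reduced.mul_right (H : Reduced (n + 1) φ) (hd : 5 ≤ d) (hn : 1 ≤ n) {ψ : MulAut (UT d F)}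
    {w : F → UT d F} (hw : ∀ x, w x ∈ Gam d F (n + 1)) (hψ : ∀ x, ψ (E 1 0 x) = E 1 0 x * w x)
    (hψ' : ∀ i x, i + 1 < d → i ≠ 0 → ψ (E (i + 1) i x) = E (i + 1) i x)
    (hc : ∀ x b, coef (w x) (b + (n + 1)) b = -ent (diff φ (E 1 0 x)) (b + (n + 1)) b) :
    Reduced (n + 1) (φ * ψ) ∧ (∀ x, dev (φ * ψ) (E 1 0 x) ∈ Gam d F (n + 1 + 1)) ∧
      ∀ i x, i + 1 < d → i ≠ 0 → dev (φ * ψ) (E (i + 1) i x) = dev φ (E (i + 1) i x) := by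
  have h1 : ∀ i x, i + 1 < d → i ≠ 0 → dev (φ * ψ) (E (i + 1) i x) = dev φ (E (i + 1) i x) :=
    fun i x hi hi0 => by rw [dev, MulAut.mul_apply, hψ' i x hi hi0, dev]
  have h2 : ∀ x, dev (φ * ψ) (E 1 0 x) ∈ Gam d F (n + 1 + 1) := by
    intro x
    -- The leading entries of the first two factors cancel by `hc`; the third lies in `Gam d F (n +
    -- 1 + n)`.
    have e : dev (φ * ψ) (E 1 0 x) = dev φ (E 1 0 x) * w x * dev φ (w x) := by
      simp only [dev, MulAut.mul_apply, hψ, map_mul]; group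
    have m1 : dev φ (E 1 0 x) ∈ Gam d F (n + 1) := H.1 0 x (by omega)
    rw [e]
    refine mul_mem (mem_Gam_succ (mul_mem m1 (hw x)) fun b => ?_)
      (Gam_anti (by omega) (H.1.dev_mem hn (by omega) _ (hw x)))
    rw [coef_mul_lead m1 (hw x) (by omega), hc, ent_diff_lead m1, add_neg_cancel]
  refine ⟨reduced_of_coef_dev (fun i x hi => ?_) fun i x b hi hs => ?_, h2, h1⟩
  · by_cases hi0 : i = 0
    · subst hi0; exact Gam_anti (by omega) (h2 x)
    · rw [h1 i x hi hi0]; exact H.1 i x hi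
  · by_cases hi0 : i = 0
    · subst hi0; exact h2 x _ _ (by omega)
    · rw [h1 i x hi hi0]; exact H.coef_dev hi hs x

/-! ### The special position `(d - 1, 2)`, on subdiagonal `d - 3`. -/

theorem Reduced.linear_of_four (hd : 5 ≤ d) (H : Reduced (n + 1) φ) (hn : n + 4 = d) (x y : F) :
    ent (diff φ (E 2 0 (y * x))) (d - 1) 1 = -(ent (diff φ (E 1 0 x)) (d - 1) 2 * y) := by
  have h1 := H.1.ent_gen_commutator (by omega) (i := 0) (by omega) x y (a := d - 1) (b := 1)
    (by omega)
  rw [if_neg (by omega), if_pos rfl, if_neg (by omega), if_neg (by omega)] at h1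
  rw [h1]
  ring

theorem Reduced.eq_mul_of_four (hd : 5 ≤ d) (H : Reduced (n + 1) φ) (hn : n + 4 = d) (x : F) :
    ent (diff φ (E 1 0 x)) (d - 1) 2 = x * ent (diff φ (E 1 0 1)) (d - 1) 2 := by
  have h1 := H.linear_of_four hd hn x 1
  have h2 := H.linear_of_four hd hn 1 x
  rw [one_mul] at h1
  rw [mul_one] at h2
  linear_combination h1 - h2

/-- The extremal automorphisms of the even type only exist over the field with two elements. -/
theorem Reduced.two_eq_zero_of_four (hd : 5 ≤ d) (H : Reduced (n + 1) φ) (hn : n + 4 = d)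
    (hc : ent (diff φ (E 1 0 1)) (d - 1) 2 ≠ 0) : (2 : F) = 0 := by
  -- `E 1 0 1` and `E 2 0 1` commute. At position `(d - 1, 0)` their contributions are the same
  -- coefficient, so twice it vanishes.
  have h1 := H.1.comm_E (i := 0) (p := 2) (q := 0) (by omega) (by omega) (by omega) (by omega)
    (by omega) (by omega) 1 1 (a := d - 1) (b := 0) (by omega)
  have h2 := H.linear_of_four hd hn 1 1
  rw [one_mul] at h2
  rw [if_neg (by omega), if_pos rfl, if_pos rfl, if_neg (by omega)] at h1
  simp only [zero_add, h2] at h1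
  refine (mul_eq_zero (b := ent (diff φ (E 1 0 1)) (d - 1) 2)).1 ?_ |>.resolve_right hc
  linear_combination h1

/-- Position `(d - 1, 0)` is one subdiagonal below the leading term of `diff_commutator_mul`. There
the right factor matters: its entry `(1, 0)`, equal to `x`, multiplies the leading entry at `(d - 1,
1)`. -/
theorem Reduced.second_order (hd : 5 ≤ d) (H : Reduced (n + 1) φ) (hn : n + 4 = d) (x y : F) :
    ent (diff φ (E 2 0 (y * x))) (d - 1) 0 - ent (diff φ (E 1 0 x)) (d - 1) 2 * y * x =
      ent (diff φ (E 2 1 y)) (d - 1) 1 * x := by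
  have hg : diff φ (E 2 1 y) ∈ band d F (n + 2) :=
    dev_mem_iff.1 (H.dev_mem_succ (i := 1) (by omega) (fun b => by unfold Special; omega) y)
  have hh : diff φ (E 1 0 x) ∈ band d F (n + 1) := level_iff.1 H.1 0 x (by omega)
  have hcm : diff φ (E 2 0 (y * x)) ∈ band d F (n + 2) := by
    have := H.1.diff_E_mem (by omega) (k := 2) (q := 0) (by omega) (by omega) (y * x)
    rwa [add_comm 2 n] at this
  have e := diff_commutator_mul φ (E 2 1 y) (E 1 0 x)
  rw [E_commutator (by omega) (by omega) (by omega)] at e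
  have e' := congrArg (fun M => ent M (d - 1) 0) e
  simp only [ent_add, ent_sub (_ + _ + _), ent_sub (diff φ (E 2 1 y) * _)] at e'
  have e1 := ent_sgl_bracket (d := d) (p := 2) (q := 1) (by omega) (by omega) y
    (diff φ (E 1 0 x)) (d - 1) 0
  have e2 := ent_bracket_sgl (d := d) (p := 1) (q := 0) (by omega) (by omega) x
    (diff φ (E 2 1 y)) (d - 1) 0
  rw [if_neg (by omega), if_neg (by omega)] at e1
  rw [if_pos rfl, if_neg (by omega), ent_sub] at e2
  rw [e1, e2, nil_E (i := 2) (j := 0) (by omega) (by omega), ent_sgl_mul (by omega) (by omega),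
    if_neg (by omega), mul_mem_band hg hh _ _ (by omega), mul_mem_band hh hg _ _ (by omega),
    toMatrix_eq, mul_add, mul_one, ent_add] at e'
  have e3 := ent_mul_lead hcm (nil_mem (φ (E 1 0 x) * φ (E 2 1 y))) 0
  rw [show 0 + (n + 2) + 1 = d - 1 by omega] at e3
  have e4 : ent (nil (φ (E 1 0 x) * φ (E 2 1 y))) (0 + 1) 0 = x := by
    change coef (φ (E 1 0 x) * φ (E 2 1 y)) 1 0 = x
    rw [coef_mul_one_zero, coef, coef, nil_map, nil_map, ent_add, ent_add, hg 1 0 (by omega),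
      hh 1 0 (by omega)]
    change coef _ 1 0 + 0 + (coef _ 1 0 + 0) = x
    rw [coef_E_self (by omega) (by omega), coef_E_of_ne (by omega) (by omega) _ (by omega)]
    ring
  rw [e3, e4, zero_add, H.linear_of_four hd hn] at e'
  linear_combination e'

theorem Reduced.eq_zero_or_one_of_four (hd : 5 ≤ d) (H : Reduced (n + 1) φ) (hn : n + 4 = d)
    (hc : ent (diff φ (E 1 0 1)) (d - 1) 2 ≠ 0) (x : F) : x = 0 ∨ x = 1 := by
  have h : ∀ x y, ent (diff φ (E 2 0 (y * x))) (d - 1) 0 -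
      x * ent (diff φ (E 1 0 1)) (d - 1) 2 * y * x = ent (diff φ (E 2 1 y)) (d - 1) 1 * x :=
    fun x y => by rw [← H.eq_mul_of_four hd hn, H.second_order hd hn]
  -- `h` has the form `f (y * x) - c * x ^ 2 * y = g y * x`. The pairs `(1, x)`, `(x, 1)`, `(x, x)`,
  -- `(x * x, 1)` eliminate `f` and `g`.
  have h1 := h 1 x
  have h2 := h x 1
  have h3 := h x x
  have h4 := h (x * x) 1
  rw [mul_one] at h1
  rw [one_mul] at h2 h4
  have : ent (diff φ (E 1 0 1)) (d - 1) 2 * (x * (x - 1)) ^ 2 = 0 := by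
    linear_combination h3 - h4 + x * h2 - x * h1
  rcases mul_eq_zero.1 this with h | h
  · exact absurd h hc
  · rcases mul_eq_zero.1 (pow_eq_zero_iff two_ne_zero |>.1 h) with h | h
    · exact Or.inl h
    · exact Or.inr (sub_eq_zero.1 h)

end reduced

/-! ### Generation of the automorphism group -/

section reduced
variable {φ : MulAut (UT d F)} {n m : ℕ}

/-- `φ * ψ` is as reduced as `φ`, and fixes the first generators to the next order, where `ψ`
fixes the other generators. -/
def KillsFirst (m : ℕ) (φ ψ : MulAut (UT d F)) : Prop :=
  Reduced m (φ * ψ) ∧ (∀ x, dev (φ * ψ) (E 1 0 x) ∈ Gam d F (m + 1)) ∧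
    ∀ i x, i + 1 < d → i ≠ 0 → dev (φ * ψ) (E (i + 1) i x) = dev φ (E (i + 1) i x)

theorem Reduced.killsFirst_one (hd : 5 ≤ d) (H : Reduced m φ)
    (h : ∀ x b, ent (diff φ (E 1 0 x)) (b + m) b = 0) : KillsFirst m φ 1 := by
  have h1 : ∀ x, dev φ (E 1 0 x) ∈ Gam d F m := fun x => H.1 0 x (by omega)
  rw [KillsFirst, mul_one]
  exact ⟨H, fun x => mem_Gam_succ (h1 x) fun b => by rw [← ent_diff_lead (h1 x), h],
    fun _ _ _ _ => rfl⟩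

theorem exists_killsFirst_of_four (hd : 5 ≤ d) (H : Reduced (n + 1) φ) (hn : n + 4 = d) :
    ∃ ψ ∈ autGen F hd, KillsFirst (n + 1) φ ψ := by
  have hz : ∀ x b, b ≠ 2 → ent (diff φ (E 1 0 x)) (b + (n + 1)) b = 0 := fun x b hb =>
    H.2 0 x b (by omega) (by unfold Special; omega)
  by_cases hc : ent (diff φ (E 1 0 1)) (d - 1) 2 = 0
  · refine ⟨1, one_mem _, H.killsFirst_one hd fun x b => ?_⟩
    by_cases hb : b = 2
    · rw [hb, show 2 + (n + 1) = d - 1 by omega, H.eq_mul_of_four hd hn, hc, mul_zero]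
    · exact hz x b hb
  · have h2 := H.two_eq_zero_of_four hd hn hc
    have hF := H.eq_zero_or_one_of_four hd hn hc
    refine ⟨extremalEven hd h2 hF, autGen_of_isExtremal hd (Or.inr
      ⟨CharP.ringChar_of_prime_eq_zero Nat.prime_two (by exact_mod_cast h2),
        isExtremalEven_extremalEven hd h2 hF⟩),
      H.mul_right hd (by omega) (w := fun x => lastRow hd 0 0 x)
        (fun x => lastRow_mem hd (Or.inl (by omega))) (extremalEven_first hd h2 hF)
        (fun i x hi hi0 => extremalEven_gen hd h2 hF hi hi0 x) fun x b => ?_⟩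
    by_cases hb : b = 2
    · rw [hb, show 2 + (n + 1) = d - 1 by omega, H.eq_mul_of_four hd hn,
        (hF _).resolve_left hc, coef_lastRow, if_pos rfl]
      simp only [OfNat.ofNat_ne_zero, OfNat.ofNat_ne_one, if_true, if_false]
      linear_combination x * h2
    · rw [hz x b hb, coef_lastRow]
      split_ifs <;> simp

/-! ### The special position `(d - 1, 1)`, on subdiagonal `d - 2`. -/

theorem Reduced.eq_mul_of_three (hd : 5 ≤ d) (H : Reduced (n + 1) φ) (hn : n + 3 = d) (x : F) :
    ent (diff φ (E 1 0 x)) (d - 1) 1 = ent (diff φ (E 1 0 1)) (d - 1) 1 * x := by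
  have h1 := H.1.comm_E (i := 0) (p := 1) (q := 0) (by omega) (by omega) (by omega) (by omega)
    (by omega) (by omega) x 1 (a := d - 1) (b := 0) (by omega)
  rw [if_neg (by omega), if_pos rfl, if_pos rfl, if_neg (by omega)] at h1
  simp only [zero_add] at h1
  linear_combination h1

/-- This is the functional equation required of `lam` in an odd extremal automorphism, so the
inverse correction can be read off from `φ` itself. -/
theorem Reduced.last_entry_add (hd : 5 ≤ d) (H : Reduced (n + 1) φ) (hn : n + 3 = d) (x y : F) :
    coef (φ (E 1 0 (x + y))) (d - 1) 0 - coef (φ (E 1 0 x)) (d - 1) 0 -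
      coef (φ (E 1 0 y)) (d - 1) 0 = ent (diff φ (E 1 0 1)) (d - 1) 1 * x * y := by
  have hx : diff φ (E 1 0 x) ∈ band d F (n + 1) := level_iff.1 H.1 0 x (by omega)
  have hy : diff φ (E 1 0 y) ∈ band d F (n + 1) := level_iff.1 H.1 0 y (by omega)
  have h1 : (1 : ℕ) < d := by omega
  rw [E_add h1 (by omega), map_mul, coef_mul, nil_map, nil_map, mul_add, add_mul,
    add_mul, ent_add, ent_add, ent_add, mul_mem_band hx hy _ _ (by omega),
    nil_E h1 (by omega), nil_E h1 (by omega),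
    ent_sgl_mul h1 (by omega), ent_sgl_mul h1 (by omega), if_neg (by omega), if_neg (by omega),
    ent_mul_sgl h1 (by omega), if_pos rfl, H.eq_mul_of_three hd hn]
  ring

theorem exists_killsFirst_of_three (hd : 5 ≤ d) (H : Reduced (n + 1) φ) (hn : n + 3 = d) :
    ∃ ψ ∈ autGen F hd, KillsFirst (n + 1) φ ψ := by
  have hz : ∀ x b, b ≠ 1 → ent (diff φ (E 1 0 x)) (b + (n + 1)) b = 0 := fun x b hb =>
    H.2 0 x b (by omega) (by unfold Special; omega)
  have hadd := H.last_entry_add hd hn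
  by_cases h2 : ringChar F = 2
  · have hc : ent (diff φ (E 1 0 1)) (d - 1) 1 = 0 := by
      have h20 : (1 + 1 : F) = 0 := by
        have := ringChar.Nat.cast_ringChar (R := F)
        rw [h2] at this
        rw [one_add_one_eq_two]
        exact_mod_cast this
      have e1 := hadd 1 1
      have e0 := hadd 0 0
      rw [h20] at e1
      simp only [add_zero, mul_zero, mul_one] at e0 e1
      linear_combination -e1 - e0 - coef (φ (E 1 0 1)) (d - 1) 0 * h20
    refine ⟨1, one_mem _, H.killsFirst_one hd fun x b => ?_⟩
    by_cases hb : b = 1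
    · rw [hb, show 1 + (n + 1) = d - 1 by omega, H.eq_mul_of_three hd hn, hc, zero_mul]
    · exact hz x b hb
  · have hl : ∀ x y : F, -coef (φ (E 1 0 (x + y))) (d - 1) 0 - -coef (φ (E 1 0 x)) (d - 1) 0 -
        -coef (φ (E 1 0 y)) (d - 1) 0 = -ent (diff φ (E 1 0 1)) (d - 1) 1 * x * y := fun x y => by
      linear_combination -hadd x y
    refine ⟨extremalOdd hd _ (fun x => -coef (φ (E 1 0 x)) (d - 1) 0) hl, autGen_of_isExtremal hd
      (Or.inl ⟨h2, isExtremalOdd_extremalOdd hd _ _ hl⟩),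
      H.mul_right hd (by omega) (w := fun x => lastRow hd _ _ 0)
        (fun x => lastRow_mem hd (Or.inr ⟨by omega, rfl⟩)) (extremalOdd_first hd _ _ hl)
        (fun i x hi hi0 => extremalOdd_gen hd _ _ hl hi hi0 x) fun x b => ?_⟩
    rw [coef_lastRow]
    by_cases hb : b = 1
    · rw [hb, if_pos (by omega), if_neg one_ne_zero, if_pos rfl,
        show 1 + (n + 1) = d - 1 by omega, H.eq_mul_of_three hd hn x]
      ring
    · rw [hz x b hb]
      split_ifs <;> first | omega | simp

theorem exists_killsFirst (hd : 5 ≤ d) (H : Reduced (n + 1) φ) (hn : n + 4 = d ∨ n + 3 = d) :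
    ∃ ψ ∈ autGen F hd, KillsFirst (n + 1) φ ψ :=
  hn.elim (exists_killsFirst_of_four hd H) (exists_killsFirst_of_three hd H)

/-- Conjugating by the flip exchanges the first and last generators, so `exists_killsFirst` applies
twice. The second correction fixes the generators other than the first and so keeps the gain of the
first one. -/
theorem exists_level_succ_of_reduced (hd : 5 ≤ d) (H : Reduced (n + 1) φ)
    (hn : n + 4 = d ∨ n + 3 = d) :
    ∃ α ∈ autGen F hd, ∃ β ∈ autGen F hd, Level (n + 1 + 1) (α * φ * β) := by
  obtain ⟨ψ, hψ, R1, k1, -⟩ := exists_killsFirst hd H hn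
  have R2 := R1.flip_conj (by omega)
  obtain ⟨ψ', hψ', R3, k3, e3⟩ := exists_killsFirst hd R2 hn
  have hf := flip_mem_autGen (F := F) hd
  refine ⟨flip d F, hf, ψ * flip d F * ψ', mul_mem (mul_mem hψ hf) hψ', fun i x hi => ?_⟩
  have e : flip d F * φ * (ψ * flip d F * ψ') = flip d F * (φ * ψ) * flip d F * ψ' := by
    simp only [mul_assoc]
  rw [e]
  by_cases hi0 : i = 0
  · subst hi0; exact k3 x
  by_cases hi1 : i + 2 = d
  · rw [e3 i x hi hi0, dev_flip_conj, map_mem_Gam, flip_gen hi, show d - 2 - i = 0 by omega]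
    exact k1 x
  · exact R3.dev_mem_succ hi (fun b => by unfold Special; omega) x

theorem exists_level (hd : 5 ≤ d) (φ : MulAut (UT d F)) (hm : n + 2 < d) :
    ∃ α ∈ autGen F hd, ∃ β ∈ autGen F hd, Level (n + 2) (α * φ * β) := by
  induction n with
  | zero =>
    obtain ⟨ψ, hψ, h⟩ := exists_level_two hd φ
    exact ⟨ψ, hψ, 1, one_mem _, by rwa [mul_one]⟩
  | succ n ih =>
    obtain ⟨α, hα, β, hβ, h⟩ := ih (by omega)
    obtain ⟨s, R⟩ := h.exists_reduced hd (by omega) (by omega)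
    have hs := conj_mem_autGen (F := F) hd s
    -- Special positions occur only on the subdiagonals `d - 3` and `d - 2`; above these, being
    -- reduced already raises the level.
    by_cases hn : n + 5 < d
    · refine ⟨MulAut.conj s * α, mul_mem hs hα, β, hβ, fun i x hi => ?_⟩
      have := R.dev_mem_succ hi (fun b => by unfold Special; omega) x
      simpa only [mul_assoc] using this
    · obtain ⟨γ, hγ, δ, hδ, h'⟩ := exists_level_succ_of_reduced hd R (by omega)
      refine ⟨γ * (MulAut.conj s * α), mul_mem hγ (mul_mem hs hα), β * δ, mul_mem hβ hδ, ?_⟩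
      simpa only [mul_assoc] using h'

/-- All deviations lie in the central subgroup `Gam d F (d - 1)`, so `φ s` and `s` induce the same
inner automorphism. -/
theorem Level.mem_centralAuts (hn : 1 ≤ n) (hd : n + 2 = d) (H : Level (n + 1) φ) :
    φ ∈ centralAuts d F := by
  refine Subgroup.mem_centralizer_iff.2 ?_
  rintro _ ⟨s, rfl⟩
  ext1 g
  have h1 : dev φ s ∈ Gam d F (d - 1) := Gam_anti (by omega) (H.dev_mem hn le_rfl s (mem_Gam_one s))
  have h2 : dev φ s * φ g = φ g * dev φ s :=
    commutatorElement_eq_one_iff_mul_comm.1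
      (Gam_le_eq_one le_rfl (commutator_mem_Gam h1 (mem_Gam_one _) (by omega)))
  have h3 : φ s = s * dev φ s := (mul_dev φ s).symm
  simp only [MulAut.mul_apply, MulAut.conj_apply, map_mul, map_inv, h3]
  rw [mul_assoc s (dev φ s), h2]
  group

theorem mem_autGen (hd : 5 ≤ d) (φ : MulAut (UT d F)) : φ ∈ autGen F hd := by
  obtain ⟨n, rfl⟩ : ∃ n, d = n + 3 := ⟨d - 3, by omega⟩
  obtain ⟨α, hα, β, hβ, h⟩ := exists_level hd φ (n := n) (by omega)
  have := autGen_of_mem_centralAuts hd (Level.mem_centralAuts (n := n + 1) (by omega) rfl h)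
  rwa [Subgroup.mul_mem_cancel_right _ hβ, Subgroup.mul_mem_cancel_left _ hα] at this

/-! ### Extremal automorphisms in characteristic `2` -/

theorem nonempty_ringEquiv_zmod_two (h2 : (2 : F) = 0) (hF : ∀ x : F, x = 0 ∨ x = 1) :
    Nonempty (F ≃+* ZMod 2) := by
  have : CharP F 2 := 
    (CharP.charP_iff_prime_eq_zero Nat.prime_two).2 (by exact_mod_cast h2)
  refine ⟨(RingEquiv.ofBijective (ZMod.castHom (dvd_refl 2) F)
    ⟨RingHom.injective _, fun x => ?_⟩).symm⟩
  rcases hF x with rfl | rfl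
  · exact ⟨0, map_zero _⟩
  · exact ⟨1, map_one _⟩

theorem Reduced.nonempty_ringEquiv (hd : 5 ≤ d) (H : Reduced (n + 1) φ) (hn : n + 4 = d) {x : F}
    (hx : ent (diff φ (E 1 0 x)) (d - 1) 2 ≠ 0) : Nonempty (F ≃+* ZMod 2) := by
  have hc : ent (diff φ (E 1 0 1)) (d - 1) 2 ≠ 0 := fun h => hx (by
    rw [H.eq_mul_of_four hd hn, h, mul_zero])
  exact nonempty_ringEquiv_zmod_two (H.two_eq_zero_of_four hd hn hc)
    (H.eq_zero_or_one_of_four hd hn hc)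

theorem toMatrix_E_mul_E {i j p q : ℕ} (hi : i < d) (hj : j < i) (hp : p < d) (hq : q < p)
    (h : j ≠ p) (x y : F) :
    toMatrix (E i j x * E p q y : UT d F) = 1 + sgl i j x + sgl p q y := by
  rw [toMatrix_eq, nil_mul, nil_E hi hj, nil_E hp hq, sgl_mul_sgl hi (by omega) hp (by omega),
    if_neg h, add_zero, add_assoc]

/-- An automorphism multiplying the generators at `(i + 1, i)` by elements at a special position
and fixing the other generators is reduced. -/
theorem reduced_of_gen {i p q : ℕ} (hn : n + 4 = d) (hi : i + 1 < d) (hp : p < d)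
    (hq : p = q + (n + 1)) (hs : Special d i p q) {a : F}
    (h : ∀ x, φ (E (i + 1) i x) = E (i + 1) i x * E p q (a * x))
    (h' : ∀ j x, j + 1 < d → j ≠ i → φ (E (j + 1) j x) = E (j + 1) j x) :
    Reduced (n + 1) φ ∧ (a = 0 → Level (n + 3) φ) := by
  have e : ∀ x, dev φ (E (i + 1) i x) = E p q (a * x) := fun x => by rw [dev, h]; group
  have e' : ∀ j x, j + 1 < d → j ≠ i → dev φ (E (j + 1) j x) = 1 := fun j x hj hji => by
    rw [dev, h' j x hj hji]; group
  have hE : ∀ x : F, E p q (a * x) ∈ Gam d F (n + 1) := fun x =>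
    E_mem_Gam hp (by omega) (by omega) _
  refine ⟨reduced_of_coef_dev (fun j x hj => ?_) fun j x b hj hsp => ?_, fun ha j x hj => ?_⟩
  · by_cases hji : j = i
    · subst hji; rw [e]; exact hE x
    · rw [e' j x hj hji]; exact one_mem _
  · by_cases hji : j = i
    · subst hji
      rw [e, coef_E_of_ne hp (by omega)]
      rintro ⟨rfl, rfl⟩
      exact hsp hs
    · rw [e' j x hj hji, coef_one]
  · by_cases hji : j = i
    · subst hji; rw [e, ha, zero_mul, E_zero]; exact one_mem _
    · rw [e' j x hj hji]; exact one_mem _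

end reduced

theorem FixesOtherGens.apply_E {φ : MulAut (UT d F)} {p q : Fin d} (h : FixesOtherGens φ p q)
    (j : ℕ) (x : F) (hj : j + 1 < d) (hne : j ≠ q) : φ (E (j + 1) j x) = E (j + 1) j x := by
  have := h ⟨j + 1, hj⟩ ⟨j, by omega⟩ rfl
    (fun e => hne (congrArg (fun r => (r.2 : ℕ)) e)) x
  rwa [gen_eq_E] at this

/-- Such a `φ` is itself reduced, with `a` as its special leading entry at `x = 1`, so the two
relations for position `(d - 1, 2)` apply. If `a = 0`, it fixes all generators and is central. The
second kind is reduced to the first by the flip. -/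
theorem nonempty_ringEquiv_of_isExtremalEven (hd : 5 ≤ d) {φ : MulAut (UT d F)}
    (hφ : IsExtremalEven hd φ) (hc : φ ∉ centralAuts d F) : Nonempty (F ≃+* ZMod 2) := by
  obtain ⟨n, rfl⟩ : ∃ n, d = n + 4 := ⟨d - 4, by omega⟩
  obtain ⟨a, ⟨h, h'⟩ | ⟨h, h'⟩⟩ := hφ
  · have g : ∀ x, φ (E 1 0 x) = E 1 0 x * E (n + 3) 2 (a * x) := fun x => by
      refine toMatrix_injective ?_
      rw [toMatrix_E_mul_E (by omega) (by omega) (by omega) (by omega) (by omega)]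
      refine ((congrArg (fun g => toMatrix (φ g)) (gen_eq_E _ _ rfl _)).symm.trans (h x)).trans ?_
      rw [← sgl_val, ← sgl_val]
      simp only [i₁, i₂, i₃, Fin.val_rev]
      rfl
    obtain ⟨R, hL⟩ := reduced_of_gen (n := n) rfl (i := 0) (p := n + 3) (q := 2) (by omega)
      (by omega) (by omega) (by unfold Special; omega) g fun j x hj hj0 => h'.apply_E j x hj hj0
    have ha : a ≠ 0 := fun ha => hc (Level.mem_centralAuts (n := n + 2) (by omega) rfl (hL ha))
    refine R.nonempty_ringEquiv hd rfl (x := 1) ?_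
    have e := ent_diff_lead (R.1 0 1 (by omega)) 2
    rw [show 2 + (n + 1) = n + 3 by omega] at e
    change ent _ (n + 3) 2 ≠ 0
    rw [e, dev]
    change coef ((E 1 0 1)⁻¹ * φ (E 1 0 1)) (n + 3) 2 ≠ 0
    rw [g, inv_mul_cancel_left, coef_E_self (by omega) (by omega), mul_one]
    exact ha
  · have hr : ((i₁ hd).rev : ℕ) = (i₂ hd).rev + 1 := by simp only [Fin.val_rev, i₁, i₂]; omega
    have g : ∀ x, φ (E (n + 2 + 1) (n + 2) x) = E (n + 2 + 1) (n + 2) x * E (n + 1) 0 (a * x) := by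
      intro x
      refine toMatrix_injective ?_
      rw [toMatrix_E_mul_E (by omega) (by omega) (by omega) (by omega) (by omega)]
      refine ((congrArg (fun g => toMatrix (φ g)) (gen_eq_E _ _ hr _)).symm.trans (h x)).trans ?_
      rw [← sgl_val, ← sgl_val]
      simp only [i₁, i₂, i₃, Fin.val_rev]
      rfl
    obtain ⟨R, hL⟩ := reduced_of_gen (n := n) rfl (i := n + 2) (p := n + 1) (q := 0) (by omega)
      (by omega) (by omega) (by unfold Special; omega) g fun j x hj hj0 => h'.apply_E j x hj hj0
    have ha : a ≠ 0 := fun ha => hc (Level.mem_centralAuts (n := n + 2) (by omega) rfl (hL ha))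
    have R' := R.flip_conj (by omega)
    refine R'.nonempty_ringEquiv hd rfl (x := 1) ?_
    have e := ent_diff_lead (R'.1 0 1 (by omega)) 2
    rw [show 2 + (n + 1) = n + 3 by omega] at e
    change ent _ (n + 3) 2 ≠ 0
    rw [e, dev_flip_conj, flip_gen (by omega)]
    rw [Ne, coef_flip_eq_zero_iff (R.1 _ _ (by omega)) (by omega) (by omega) (by omega)]
    change coef ((E (n + 2 + 1) (n + 2) 1)⁻¹ * φ (E (n + 2 + 1) (n + 2) 1)) (n + 1)
      (n + 3 - (n + 3)) ≠ 0
    rw [g, inv_mul_cancel_left, Nat.sub_self, coef_E_self (by omega) (by omega), mul_one]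
    exact ha

end UT

theorem mainTheorem1 (d : ℕ) (hd : 5 ≤ d) (F : Type*) [Field F] :
    Subgroup.closure
        ({φ : MulAut (UT d F) | UT.IsExtremal hd φ} ∪ {φ | UT.IsFieldAut φ} ∪
          {φ | UT.IsDiagonalAut φ} ∪ (UT.innerAuts d F : Set (MulAut (UT d F))) ∪
          (UT.centralAuts d F : Set (MulAut (UT d F))) ∪ {φ | UT.IsFlip φ}) = ⊤ ∧
      (ringChar F = 2 →
        (∃ φ : MulAut (UT d F), UT.IsExtremal hd φ ∧ φ ∉ UT.centralAuts d F) →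
        Nonempty (F ≃+* ZMod 2)) := by
  refine ⟨(Subgroup.eq_top_iff' _).2 (UT.mem_autGen hd), ?_⟩
  rintro h2 ⟨φ, ⟨hne, -⟩ | ⟨-, hφ⟩, hc⟩
  · exact absurd h2 hne
  · exact UT.nonempty_ringEquiv_of_isExtremalEven hd hφ hc
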